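/- Proposition. Work over $\mathbb{C}$. Let $W$ be a complex vector space of dimension $6$ and let $V\subset\Lambda^2W^\vee$ be a $6$-dimensional subspace of skew-forms on $W$ that contains no skew-form of rank $2$. Let $X\subset\mathbb{P}(V)$ be the corresponding pfaffian cubic fourfold, i.e. the locus of degenerate skew-forms in $\mathbb{P}(V)$ (here $\mathbb{P}$ denotes the space of lines). Every form $\omega\in X$ has rank $4$, so its kernel $K_\omega=\{w\in W:\omega(w,-)=0\}$ has dimension $2$; these kernels form a rank $2$ vector bundle $\mathcal{K}\subset W\otimes\mathcal{O}_X$. Let $$\mathbb{P}_X(\mathcal{K})=\{([\omega],[w])\in\mathbb{P}(V)\times\mathbb{P}(W):[\omega]\in X,\ w\in K_\omega\}$$ and let $p:\mathbb{P}_X(\mathcal{K})\to\mathbb{P}(W)$, $([\omega],[w])\mapsto[w]$, be the canonical map. Let $V^\perp\subset\Lambda^2W$ be the annihilator of $V$, let $S=\mathrm{Gr}(2,W)\cap\mathbb{P}(V^\perp)\subset\mathbb{P}(\Lambda^2W)$ (which is the K3 surface associated with $X$ when $X$ is smooth), let $\mathcal{U}\subset W\otimes\mathcal{O}_S$ be the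 restriction to $S$ of the tautological rank $2$ bundle of $\mathrm{Gr}(2,W)$, let $\mathbb{P}_S(\mathcal{U})=\{(U,[w]): U\in S,\ w\in U\}$, and let $q:\mathbb{P}_S(\mathcal{U})\to\mathbb{P}(W)$, $(U,[w])\mapsto[w]$, be the canonical map. Then the map $p:\mathbb{P}_X(\mathcal{K})\to\mathbb{P}(W)$ is birational, and the indeterminacy locus of the inverse rational map $\mathbb{P}(W)\dashrightarrow\mathbb{P}_X(\mathcal{K})$ (the set of points at which it is not defined) coincides with the image of $q$. -/

import Mathlib

noncomputable section

namespace ClassicalAG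

open TopologicalSpace MvPolynomial
open scoped LinearAlgebra.Projectivization

universe u v

/-! ### Spaces with functions

Classical complex varieties are treated as topological spaces (of closed points, with the Zariski
topology) carrying a sheaf of `ℂ`-valued regular functions. -/

/-- A space with functions over `ℂ`: a topological space together with, for every open set `U`, a
`ℂ`-algebra of functions `U → ℂ`, called regular functions, such that restrictions of regular
functions are regular and a function that is locally regular is regular. -/
structure SpaceWithFunctions where
  /-- the set of points -/
  Pt : Type u
  [top : TopologicalSpace Pt]
  /-- the regular functions on an open set -/
  reg : (U : Opens Pt) → Subalgebra ℂ (U → ℂ)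
  res : ∀ {U V : Opens Pt} (h : U ≤ V) (f : V → ℂ), f ∈ reg V → (fun x : U => f ⟨x, h x.2⟩) ∈ reg U
  glue : ∀ {U : Opens Pt} (f : U → ℂ),
    (∀ x : U, ∃ (N : Opens Pt) (h : N ≤ U), (x : Pt) ∈ N ∧ (fun y : N => f ⟨y, h y.2⟩) ∈ reg N) →
      f ∈ reg U

namespace SpaceWithFunctions

instance : CoeSort SpaceWithFunctions.{u} (Type u) := ⟨Pt⟩

instance (X : SpaceWithFunctions.{u}) : TopologicalSpace X := X.top

/-- A subset of a space with functions, with the induced topology; the regular functions are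
those which locally are restrictions of regular functions of the ambient space. -/
def restrict (X : SpaceWithFunctions.{u}) (Z : Set X) : SpaceWithFunctions.{u} where
  Pt := Z
  top := instTopologicalSpaceSubtype
  reg U :=
    { carrier := {f | ∀ x : U, ∃ (N : Opens X) (g : N → ℂ), g ∈ X.reg N ∧ (x : Z).1 ∈ N ∧
        ∀ (y : U) (hy : (y : Z).1 ∈ N), f y = g ⟨(y : Z).1, hy⟩}
      mul_mem' := by
        intro a b ha hb x
        obtain ⟨N, g, hg, hx, e⟩ := ha x
        obtain ⟨N', g', hg', hx', e'⟩ := hb x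
        exact ⟨N ⊓ N', _, (X.reg _).mul_mem (X.res inf_le_left g hg) (X.res inf_le_right g' hg'),
          ⟨hx, hx'⟩, fun y hy => by simp [e y hy.1, e' y hy.2]⟩
      add_mem' := by
        intro a b ha hb x
        obtain ⟨N, g, hg, hx, e⟩ := ha x
        obtain ⟨N', g', hg', hx', e'⟩ := hb x
        exact ⟨N ⊓ N', _, (X.reg _).add_mem (X.res inf_le_left g hg) (X.res inf_le_right g' hg'),
          ⟨hx, hx'⟩, fun y hy => by simp [e y hy.1, e' y hy.2]⟩
      algebraMap_mem' := fun c x =>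
        ⟨⊤, _, (X.reg ⊤).algebraMap_mem c, trivial, fun y hy => by simp⟩ }
  res := by
    intro U V h f hf x
    obtain ⟨N, g, hg, hx, e⟩ := hf ⟨x, h x.2⟩
    exact ⟨N, g, hg, hx, fun y hy => e ⟨y, h y.2⟩ hy⟩
  glue := by
    intro U f hf x
    obtain ⟨N, h, hx, hN⟩ := hf x
    obtain ⟨N', g, hg, hx', e⟩ := hN ⟨x, hx⟩
    obtain ⟨O, hO, hON⟩ := isOpen_induced_iff.1 N.isOpen
    refine ⟨N' ⊓ ⟨O, hO⟩, _, X.res inf_le_left g hg, ⟨hx', ?_⟩, fun y hy => ?_⟩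
    · have : (x : Z) ∈ Subtype.val ⁻¹' O := by rw [hON]; exact hx
      exact this
    · have hyN : (y : Z) ∈ N := by
        have : (y : Z) ∈ Subtype.val ⁻¹' O := hy.2
        rw [hON] at this
        exact this
      exact e ⟨y, hyN⟩ hy.1

/-- An open subset of a space with functions. -/
abbrev openSubspace (X : SpaceWithFunctions.{u}) (U : Opens X) : SpaceWithFunctions.{u} :=
  X.restrict (U : Set X)

/-- A morphism of spaces with functions is a continuous map that pulls regular functions back to
regular functions. -/
structure IsMorphism {X : SpaceWithFunctions.{u}} {Y : SpaceWithFunctions.{v}} (f : X → Y) :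
    Prop where
  continuous : Continuous f
  pullback : ∀ (U : Opens Y) (g : U → ℂ), g ∈ Y.reg U →
    (fun x : U.comap ⟨f, continuous⟩ => g ⟨f x, x.2⟩) ∈ X.reg (U.comap ⟨f, continuous⟩)

/-- A partial map from `X` to `Y`: a morphism defined on a dense open subset of `X`. A rational
map is an equivalence class of partial maps for the relation `PartialMap.Equiv` below. -/
structure PartialMap (X : SpaceWithFunctions.{u}) (Y : SpaceWithFunctions.{v}) where
  domain : Opens X
  dense_domain : Dense (domain : Set X)
  toFun : X.openSubspace domain → Y
  isMorphism : IsMorphism toFun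

/-- Two partial maps represent the same rational map if they agree on a dense open subset. -/
def PartialMap.Equiv {X : SpaceWithFunctions.{u}} {Y : SpaceWithFunctions.{v}}
    (f g : PartialMap X Y) : Prop :=
  ∃ U : Opens X, Dense (U : Set X) ∧ ∃ (hf : U ≤ f.domain) (hg : U ≤ g.domain),
    ∀ (x : X) (hx : x ∈ U), f.toFun ⟨x, hf hx⟩ = g.toFun ⟨x, hg hx⟩

/-- The domain of definition of the rational map represented by `f`: all points at which some
representative is defined. -/
def PartialMap.domainOfDefinition {X : SpaceWithFunctions.{u}} {Y : SpaceWithFunctions.{v}}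
    (f : PartialMap X Y) : Set X :=
  {x | ∃ g : PartialMap X Y, g.Equiv f ∧ x ∈ g.domain}

/-- The indeterminacy locus of the rational map represented by `f`. -/
def PartialMap.indeterminacyLocus {X : SpaceWithFunctions.{u}} {Y : SpaceWithFunctions.{v}}
    (f : PartialMap X Y) : Set X :=
  (f.domainOfDefinition)ᶜ

/-- `g` represents a rational inverse of `p : X → Y`: there are dense open subsets of `X` and `Y`
between which `p` and `g` are mutually inverse. -/
def IsRationalInverse {X : SpaceWithFunctions.{u}} {Y : SpaceWithFunctions.{v}} (p : X → Y)
    (g : PartialMap Y X) : Prop :=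
  ∃ (U : Opens X) (U' : Opens Y) (hU' : U' ≤ g.domain), Dense (U : Set X) ∧ Dense (U' : Set Y) ∧
    (∀ x ∈ U, ∃ hx : p x ∈ U', g.toFun ⟨p x, hU' hx⟩ = x) ∧
    (∀ (y : Y) (hy : y ∈ U'), g.toFun ⟨y, hU' hy⟩ ∈ U ∧ p (g.toFun ⟨y, hU' hy⟩) = y)

/-- A map `p` is a birational morphism: it is a morphism and has a rational inverse. -/
def IsBirational {X : SpaceWithFunctions.{u}} {Y : SpaceWithFunctions.{v}} (p : X → Y) : Prop :=
  IsMorphism p ∧ ∃ g : PartialMap Y X, IsRationalInverse p g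

/-! ### Projective spaces and their products -/

/-- The space with functions defined by a graded system of forms `Γ` on a set `X`: the open sets
are the unions of the sets `{f ≠ 0}` for forms `f`, and the regular functions are those which
locally are quotients of two forms of the same degree. -/
def ofForms {X : Type u} {M : Type} [AddCommMonoid M] (Γ : M → Submodule ℂ (X → ℂ))
    [SetLike.GradedMonoid Γ] : SpaceWithFunctions.{u} where
  Pt := X
  top := generateFrom {U | ∃ (m : M) (f : X → ℂ), f ∈ Γ m ∧ U = {x | f x ≠ 0}}
  reg :=
    letI := generateFrom {U : Set X | ∃ (m : M) (f : X → ℂ), f ∈ Γ m ∧ U = {x | f x ≠ 0}}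
    fun U =>
    { carrier := {f | ∀ x : U, ∃ (N : Opens X) (m : M) (a b : X → ℂ), a ∈ Γ m ∧ b ∈ Γ m ∧
        (x : X) ∈ N ∧ ∀ y : U, (y : X) ∈ N → b y ≠ 0 ∧ f y = a y / b y}
      mul_mem' := by
        intro f g hf hg x
        obtain ⟨N, m, a, b, ha, hb, hx, e⟩ := hf x
        obtain ⟨N', m', a', b', ha', hb', hx', e'⟩ := hg x
        refine ⟨N ⊓ N', m + m', a * a', b * b', SetLike.mul_mem_graded ha ha',
          SetLike.mul_mem_graded hb hb', ⟨hx, hx'⟩, fun y hy => ?_⟩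
        obtain ⟨h1, h2⟩ := e y hy.1
        obtain ⟨h1', h2'⟩ := e' y hy.2
        exact ⟨mul_ne_zero h1 h1', by simp [h2, h2', div_mul_div_comm]⟩
      add_mem' := by
        intro f g hf hg x
        obtain ⟨N, m, a, b, ha, hb, hx, e⟩ := hf x
        obtain ⟨N', m', a', b', ha', hb', hx', e'⟩ := hg x
        refine ⟨N ⊓ N', m + m', a * b' + b * a', b * b',
          (Γ _).add_mem (SetLike.mul_mem_graded ha hb') (SetLike.mul_mem_graded hb ha'),
          SetLike.mul_mem_graded hb hb', ⟨hx, hx'⟩, fun y hy => ?_⟩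
        obtain ⟨h1, h2⟩ := e y hy.1
        obtain ⟨h1', h2'⟩ := e' y hy.2
        exact ⟨mul_ne_zero h1 h1', by simp [h2, h2', div_add_div _ _ h1 h1']⟩
      algebraMap_mem' := fun c x =>
        ⟨⊤, 0, c • 1, 1, (Γ 0).smul_mem c (SetLike.one_mem_graded Γ), SetLike.one_mem_graded Γ,
          trivial, fun y _ => by simp⟩ }
  res := by
    intro U V h f hf x
    obtain ⟨N, m, a, b, ha, hb, hx, e⟩ := hf ⟨x, h x.2⟩
    exact ⟨N, m, a, b, ha, hb, hx, fun y hy => e ⟨y, h y.2⟩ hy⟩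
  glue := by
    intro U f hf x
    obtain ⟨N, h, hx, hN⟩ := hf x
    obtain ⟨N', m, a, b, ha, hb, hx', e⟩ := hN ⟨x, hx⟩
    exact ⟨N ⊓ N', m, a, b, ha, hb, ⟨hx, hx'⟩, fun y hy => e ⟨y, hy.1⟩ hy.2⟩

end SpaceWithFunctions

open SpaceWithFunctions

/-- The functions on `X` obtained by substituting functions `s i` for the variables in the
weighted homogeneous polynomials of degree `m`. -/
def evalForms {X : Type u} {σ : Type v} {M : Type} [AddCommMonoid M] (w : σ → M) (s : σ → X → ℂ)
    (m : M) : Submodule ℂ (X → ℂ) :=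
  (weightedHomogeneousSubmodule ℂ w m).map (aeval s).toLinearMap

instance {X : Type u} {σ : Type v} {M : Type} [AddCommMonoid M] (w : σ → M) (s : σ → X → ℂ) :
    SetLike.GradedMonoid (evalForms w s) where
  one_mem := ⟨1, isWeightedHomogeneous_one ℂ w, map_one (aeval s)⟩
  mul_mem := by
    rintro m n _ _ ⟨p, hp, rfl⟩ ⟨q, hq, rfl⟩
    exact ⟨p * q, IsWeightedHomogeneous.mul hp hq, map_mul (aeval s) p q⟩

variable (E : Type u) [AddCommGroup E] [Module ℂ E] (F : Type u) [AddCommGroup F] [Module ℂ F]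

/-- The degree `d` forms on `ℙ(E)`: the homogeneous polynomials of degree `d` in the linear
functionals on `E`, evaluated at a chosen representative vector of each point. Vanishing of a
form, and the quotient of two forms of the same degree, do not depend on the representative. -/
abbrev projForms : ℕ → Submodule ℂ (ℙ ℂ E → ℂ) :=
  evalForms (fun _ : Module.Dual ℂ E => (1 : ℕ)) (fun l x => l x.rep)

/-- The projective space `ℙ(E)` of lines in `E`, as a variety. -/
def projSpace : SpaceWithFunctions.{u} := ofForms (projForms E)

/-- The forms of bidegree `d` on `ℙ(E) × ℙ(F)`: the bihomogeneous polynomials in the linear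
functionals on `E` and on `F`, evaluated at chosen representatives. -/
abbrev biprojForms : ℕ × ℕ → Submodule ℂ (ℙ ℂ E × ℙ ℂ F → ℂ) :=
  evalForms
    (Sum.elim (fun _ : Module.Dual ℂ E => ((1, 0) : ℕ × ℕ)) (fun _ : Module.Dual ℂ F => (0, 1)))
    (Sum.elim (fun l z => l z.1.rep) (fun l z => l z.2.rep))

/-- The product `ℙ(E) × ℙ(F)`, as a variety (not with the product topology). -/
def biprojSpace : SpaceWithFunctions.{u} := ofForms (biprojForms E F)

variable {E F}

theorem eval_scale {σ : Type v} {M : Type} [AddCommMonoid M] {w : σ → M} {m : M}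
    {P : MvPolynomial σ ℂ} (hP : P ∈ weightedHomogeneousSubmodule ℂ w m)
    (c : Multiplicative M →* ℂ) (s : σ → ℂ) :
    eval (fun i => c (.ofAdd (w i)) * s i) P = c (.ofAdd m) * eval s P := by
  rw [eval_eq, eval_eq, Finset.mul_sum]
  refine Finset.sum_congr rfl fun d hd => ?_
  have hd' : Finsupp.weight w d = m := hP (mem_support_iff.1 hd)
  have : ∏ i ∈ d.support, c (.ofAdd (w i)) ^ d i = c (.ofAdd m) := by
    rw [← hd', Finsupp.weight_apply, Finsupp.sum, ofAdd_sum, map_prod]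
    exact Finset.prod_congr rfl fun i _ => by rw [ofAdd_nsmul, map_pow]
  simp only [mul_pow, Finset.prod_mul_distrib, this]
  ring

theorem aeval_apply_eq_eval {Y : Type u} {σ : Type v} (s : σ → Y → ℂ) (P : MvPolynomial σ ℂ)
    (x : Y) : aeval s P x = eval (fun i => s i x) P := by
  induction P using MvPolynomial.induction_on with
  | C c => simp
  | add P Q hP hQ => simp [hP, hQ]
  | mul_X P l hP => simp [hP]

/-- At the point spanned by `e`, a degree `d` form takes the value of its polynomial at `e`, up to
a factor `c ^ d` where `c ≠ 0` depends only on `e`. -/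
theorem projForms_mk (e : E) (he : e ≠ 0) : ∃ c : ℂ, c ≠ 0 ∧
    ∀ (d : ℕ) (P : MvPolynomial (Module.Dual ℂ E) ℂ), P.IsHomogeneous d →
      aeval (fun l (x : ℙ ℂ E) => l x.rep) P (Projectivization.mk ℂ e he) =
        c ^ d * eval (fun l => l e) P := by
  obtain ⟨a, ha⟩ := Projectivization.exists_smul_eq_mk_rep ℂ e he
  refine ⟨a, a.ne_zero, fun d P hP => ?_⟩
  have := eval_scale (w := fun _ : Module.Dual ℂ E => (1 : ℕ)) hP (powersHom ℂ (a : ℂ))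
    (fun l => l e)
  rw [aeval_apply_eq_eval, ← ha]
  simpa [Units.smul_def] using this

end ClassicalAG

namespace PfaffianCubic

open ClassicalAG
open scoped LinearAlgebra.Projectivization

universe u

variable {W : Type u} [AddCommGroup W] [Module ℂ W]

/-- The kernel `{w | ω(w, -) = 0}` of a skew-form `ω ∈ Λ²W^∨`. -/
def formKernel (ω : W [⋀^Fin 2]→ₗ[ℂ] ℂ) : Submodule ℂ W := LinearMap.ker ω.curryLeft

/-- The rank of a skew-form `ω`, i.e. the rank of the map `W → W^∨`, `w ↦ ω(w, -)`. -/
def formRank (ω : W [⋀^Fin 2]→ₗ[ℂ] ℂ) : ℕ := Module.finrank ℂ (LinearMap.range ω.curryLeft)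

theorem mem_formKernel {ω : W [⋀^Fin 2]→ₗ[ℂ] ℂ} {w : W} :
    w ∈ formKernel ω ↔ ∀ u : W, ω ![w, u] = 0 := by
  constructor
  · intro h u
    have : ω.curryLeft w = 0 := h
    simpa using congrArg (fun f => f ![u]) this
  · intro h
    refine LinearMap.mem_ker.2 (AlternatingMap.ext fun v => ?_)
    have hv : v = ![v 0] := by
      ext i
      fin_cases i
      rfl
    rw [hv]
    simpa using h (v 0)

variable (V : Submodule ℂ (W [⋀^Fin 2]→ₗ[ℂ] ℂ))

/-- The kernel of the skew-form corresponding to a point of `ℙ(V)`. -/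
def kernelAt (x : ℙ ℂ V) : Submodule ℂ W := formKernel (x.rep : W [⋀^Fin 2]→ₗ[ℂ] ℂ)

theorem kernelAt_mk (ω : V) (hω : ω ≠ 0) :
    kernelAt V (Projectivization.mk ℂ ω hω) = formKernel (ω : W [⋀^Fin 2]→ₗ[ℂ] ℂ) := by
  obtain ⟨a, ha⟩ := Projectivization.exists_smul_eq_mk_rep ℂ ω hω
  ext w
  rw [kernelAt, ← ha, mem_formKernel, mem_formKernel]
  simp [Units.smul_def]

/-- The pfaffian cubic `X ⊂ ℙ(V)`: the locus of degenerate skew-forms. -/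
def X : Set (ℙ ℂ V) := {x | kernelAt V x ≠ ⊥}

/-- The point set of `ℙ_X(K) ⊂ ℙ(V) × ℙ(W)`: pairs of a point `x ∈ X` and a line in the fibre
`K_x ⊂ W` at `x` of the kernel bundle. -/
def PXKSet : Set (biprojSpace V W) := {z | z.1 ∈ X V ∧ z.2.submodule ≤ kernelAt V z.1}

/-- The variety `ℙ_X(K)`. -/
def PXK : SpaceWithFunctions.{u} := (biprojSpace V W).restrict (PXKSet V)

/-- The canonical map `p : ℙ_X(K) → ℙ(W)`. -/
def p (z : PXK V) : projSpace W := z.1.2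

/-- The annihilator `V^⊥ ⊂ Λ²W` of `V ⊂ Λ²W^∨`. -/
def annihilator : Submodule ℂ (⋀[ℂ]^2 W) :=
  ⨅ ω ∈ V, LinearMap.ker (exteriorPower.alternatingMapLinearEquiv ω)

/-- The point `s` of `ℙ(Λ²W)` is the Plücker image of the two-dimensional subspace `U ⊂ W`, i.e.
`s` is the line `Λ²U ⊂ Λ²W`. -/
def IsPluckerPoint (U : Submodule ℂ W) (s : ℙ ℂ (⋀[ℂ]^2 W)) : Prop :=
  Module.finrank ℂ U = 2 ∧ s.submodule = LinearMap.range (exteriorPower.map 2 U.subtype)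

variable (W) in
/-- The Grassmannian `Gr(2, W) ⊂ ℙ(Λ²W)` in its Plücker embedding. -/
def Gr : Set (ℙ ℂ (⋀[ℂ]^2 W)) := {s | ∃ U : Submodule ℂ W, IsPluckerPoint U s}

/-- `S = Gr(2, W) ∩ ℙ(V^⊥)`. -/
def S : Set (ℙ ℂ (⋀[ℂ]^2 W)) := Gr W ∩ {s | s.submodule ≤ annihilator V}

/-- The point set of `ℙ_S(U) ⊂ ℙ(Λ²W) × ℙ(W)`: pairs of a point `s ∈ S` and a line in the fibre
`U_s ⊂ W` at `s` of the tautological bundle of the Grassmannian. -/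
def PSUSet : Set (biprojSpace (⋀[ℂ]^2 W) W) :=
  {z | z.1 ∈ S V ∧ ∃ U : Submodule ℂ W, IsPluckerPoint U z.1 ∧ z.2.submodule ≤ U}

/-- The variety `ℙ_S(U)`. -/
def PSU : SpaceWithFunctions.{u} := (biprojSpace (⋀[ℂ]^2 W) W).restrict (PSUSet V)

/-- The canonical map `q : ℙ_S(U) → ℙ(W)`. -/
def q (z : PSU V) : projSpace W := z.1.2

end PfaffianCubic

end

/-! For w ≠ 0 consider the evaluation map V → W^∨, ω ↦ ω(w, -), with 6 × 6 matrix `evMatrix`. Its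
left kernel consists of the forms in V that kill w, so the projectivized left kernel is the fibre of
p over [w]. Its right kernel consists of the u with ω(w, u) = 0 for all ω ∈ V. It always contains w,
so the matrix is singular and p is surjective. It is larger than ℂw exactly when w lies in a plane
on which all of V vanishes, that is, when [w] is in the image of q (`range_q`). Since the two
kernels have the same dimension, the image of q is the set of points over which the fibre of p is
more than one point, the complement of `corankOne`. On `corankOne` a nonzero row of the adjugate,
quintic in w, spans the left kernel and yields the inverse (`inverseMap`). At any other point no
representative of the inverse is defined: a local equation for its first coordinate would hold on a
dense part of ℙ_X(K), hence, by irreducibility, at every point of the fibre, although the fibre has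
a second point (`domainOfDefinition_subset_corankOne`).

Two facts carry the argument. The first is that `corankOne` is nonempty
(`exists_finrank_ker_evalAt_le_one`). Otherwise the forms killing a general vector all have the same
image, by first-order deformation of the vector, hence the same kernel. Two independent ones would
descend to a four-dimensional quotient, and some member of their pencil would drop rank there,
giving a form of rank 2.

The second is the irreducibility of ℙ_X(K) (`PXK_inter_nonempty`). The pairs (ω, w) are parametrized
by (ω, φ) ↦ (ω, P(ω)φ), where P(ω) is the pfaffian adjoint, whose columns span the kernel of a form
of rank 4. So it suffices that the pfaffian cubic is irreducible. A reducible cubic contains a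
hyperplane, and this would be a five-dimensional system of skew forms of constant rank 4. Such a
system does not exist (`finrank_ne_five_of_rank_four`): two independent members share a kernel
vector k, and on the space T of members killing k the polarized adjoint, contracted with a covector
φ, is a bilinear map into a space of dimension dim T. A pencil argument finds nonzero A, B ∈ T
pairing to zero. Then A + B and A - B have the same contracted adjoint, hence the same kernel, and
must be proportional, which is impossible. -/

namespace PfaffianCubic

open Matrix

/-! ### Pfaffians and pfaffian adjoints of 6 × 6 skew matrices. -/

section PfaffianAdjoint

variable {R : Type*} [CommRing R]

/-- The pfaffian of a skew-symmetric `6 × 6` matrix, as a polynomial in the entries above the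
diagonal. -/
def pf (A : Matrix (Fin 6) (Fin 6) R) : R :=
  A 0 1 * (A 2 3 * A 4 5 - A 2 4 * A 3 5 + A 2 5 * A 3 4)
    - A 0 2 * (A 1 3 * A 4 5 - A 1 4 * A 3 5 + A 1 5 * A 3 4)
    + A 0 3 * (A 1 2 * A 4 5 - A 1 4 * A 2 5 + A 1 5 * A 2 4)
    - A 0 4 * (A 1 2 * A 3 5 - A 1 3 * A 2 5 + A 1 5 * A 2 3)
    + A 0 5 * (A 1 2 * A 3 4 - A 1 3 * A 2 4 + A 1 4 * A 2 3)

/-- A bilinear version of the pfaffian of the `4 × 4` submatrix on the indices `a, b, c, d`. -/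
def pfFour (A B : Matrix (Fin 6) (Fin 6) R) (a b c d : Fin 6) : R :=
  A a b * B c d - A a c * B b d + A a d * B b c

/-- The skew-symmetric matrix with the signed complementary values of `q` as entries. -/
def complMatrix (q : Fin 6 → Fin 6 → Fin 6 → Fin 6 → R) : Matrix (Fin 6) (Fin 6) R :=
  !![0, -q 2 3 4 5, q 1 3 4 5, -q 1 2 4 5, q 1 2 3 5, -q 1 2 3 4;
     q 2 3 4 5, 0, -q 0 3 4 5, q 0 2 4 5, -q 0 2 3 5, q 0 2 3 4;
     -q 1 3 4 5, q 0 3 4 5, 0, -q 0 1 4 5, q 0 1 3 5, -q 0 1 3 4;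
     q 1 2 4 5, -q 0 2 4 5, q 0 1 4 5, 0, -q 0 1 2 5, q 0 1 2 4;
     -q 1 2 3 5, q 0 2 3 5, -q 0 1 3 5, q 0 1 2 5, 0, -q 0 1 2 3;
     q 1 2 3 4, -q 0 2 3 4, q 0 1 3 4, -q 0 1 2 4, q 0 1 2 3, 0]

theorem complMatrix_transpose (q : Fin 6 → Fin 6 → Fin 6 → Fin 6 → R) :
    (complMatrix q)ᵀ = -complMatrix q := by
  ext i j
  fin_cases i <;> fin_cases j <;> simp [complMatrix]

theorem complMatrix_add (q q' : Fin 6 → Fin 6 → Fin 6 → Fin 6 → R) :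
    complMatrix (q + q') = complMatrix q + complMatrix q' := by
  simp only [complMatrix, Matrix.of_add_of, Matrix.add_cons, Matrix.head_cons, Matrix.tail_cons,
    Matrix.empty_add_empty, Pi.add_apply, neg_add, add_zero]

theorem complMatrix_smul (c : R) (q : Fin 6 → Fin 6 → Fin 6 → Fin 6 → R) :
    complMatrix (c • q) = c • complMatrix q := by
  simp [complMatrix]

/-- A bilinear version of the pfaffian adjoint matrix, whose entries are the signed complementary
pfaffians of size four. -/
def pfBilin (A B : Matrix (Fin 6) (Fin 6) R) : Matrix (Fin 6) (Fin 6) R :=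
  complMatrix (pfFour A B)

/-- The pfaffian adjoint matrix. -/
def pfAdj (A : Matrix (Fin 6) (Fin 6) R) : Matrix (Fin 6) (Fin 6) R := pfBilin A A

theorem pfBilin_transpose (A B : Matrix (Fin 6) (Fin 6) R) : (pfBilin A B)ᵀ = -pfBilin A B :=
  complMatrix_transpose _

theorem pfBilin_add_left (A A' B : Matrix (Fin 6) (Fin 6) R) :
    pfBilin (A + A') B = pfBilin A B + pfBilin A' B := by
  rw [pfBilin, pfBilin, pfBilin, ← complMatrix_add]
  congr 1
  ext a b c d
  simp only [pfFour, Matrix.add_apply, Pi.add_apply]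
  ring

theorem pfBilin_add_right (A B B' : Matrix (Fin 6) (Fin 6) R) :
    pfBilin A (B + B') = pfBilin A B + pfBilin A B' := by
  rw [pfBilin, pfBilin, pfBilin, ← complMatrix_add]
  congr 1
  ext a b c d
  simp only [pfFour, Matrix.add_apply, Pi.add_apply]
  ring

theorem pfBilin_smul_left (k : R) (A B : Matrix (Fin 6) (Fin 6) R) :
    pfBilin (k • A) B = k • pfBilin A B := by
  rw [pfBilin, pfBilin, ← complMatrix_smul]
  congr 1
  ext a b c d
  simp only [pfFour, Matrix.smul_apply, Pi.smul_apply, smul_eq_mul]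
  ring

theorem pfBilin_smul_right (k : R) (A B : Matrix (Fin 6) (Fin 6) R) :
    pfBilin A (k • B) = k • pfBilin A B := by
  rw [pfBilin, pfBilin, ← complMatrix_smul]
  congr 1
  ext a b c d
  simp only [pfFour, Matrix.smul_apply, Pi.smul_apply, smul_eq_mul]
  ring

-- This is the expansion of the pfaffian along a row. The off-diagonal entries are expansions of
-- pfaffians with a repeated index, so they vanish.
set_option maxHeartbeats 1000000 in
theorem mul_pfAdj {A : Matrix (Fin 6) (Fin 6) R} (h : ∀ i j, A j i = -A i j)
    (h0 : ∀ i, A i i = 0) : A * pfAdj A = pf A • 1 := by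
  ext i j
  rw [Matrix.mul_apply, Fin.sum_univ_six]
  fin_cases i <;> fin_cases j <;>
    (simp [pfAdj, pfBilin, complMatrix, pfFour, pf, h0, h 0 1, h 0 2, h 0 3, h 0 4, h 0 5, h 1 2,
      h 1 3, h 1 4, h 1 5, h 2 3, h 2 4, h 2 5, h 3 4, h 3 5, h 4 5]; try ring)

/-- If the pfaffian adjoint vanishes, then all pfaffians of size four vanish. -/
theorem pfFour_eq_zero_of_pfAdj {A : Matrix (Fin 6) (Fin 6) R} (h : ∀ i j, A j i = -A i j)
    (h0 : ∀ i, A i i = 0) (hP : pfAdj A = 0) (i j k l : Fin 6) : pfFour A A i j k l = 0 := by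
  have swap12 : ∀ i j k l, pfFour A A j i k l = -pfFour A A i j k l := fun i j k l => by
    simp only [pfFour, h i j]; ring
  have swap23 : ∀ i j k l, pfFour A A i k j l = -pfFour A A i j k l := fun i j k l => by
    simp only [pfFour, h j k]; ring
  have swap34 : ∀ i j k l, pfFour A A i j l k = -pfFour A A i j k l := fun i j k l => by
    simp only [pfFour, h k l]; ring
  have e12 : ∀ i k l, pfFour A A i i k l = 0 := fun i k l => by simp only [pfFour, h0]; ring
  have e23 : ∀ i j l, pfFour A A i j j l = 0 := fun i j l => by simp only [pfFour, h0]; ring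
  have e34 : ∀ i j k, pfFour A A i j k k = 0 := fun i j k => by simp only [pfFour, h0]; ring
  have sorted : ∀ i j k l, i < j → j < k → k < l → pfFour A A i j k l = 0 := by
    have e : ∀ a b, complMatrix (pfFour A A) a b = 0 := fun a b => congrFun (congrFun hP a) b
    -- Of each transposed pair of entries, the one carrying the small pfaffian with a plus sign is
    -- taken.
    have h01 := e 1 0
    have h02 := e 0 2
    have h03 := e 3 0
    have h04 := e 0 4
    have h05 := e 5 0
    have h12 := e 2 1
    have h13 := e 1 3
    have h14 := e 4 1
    have h15 := e 1 5
    have h23 := e 3 2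
    have h24 := e 2 4
    have h25 := e 5 2
    have h34 := e 4 3
    have h35 := e 3 5
    have h45 := e 5 4
    simp [complMatrix] at h01 h02 h03 h04 h05 h12 h13 h14 h15 h23 h24 h25 h34 h35 h45
    intro i j k l hij hjk hkl
    fin_cases i <;> fin_cases j <;> (try (exact absurd hij (by decide))) <;> fin_cases k <;>
      (try (exact absurd hjk (by decide))) <;> fin_cases l <;>
      (try (exact absurd hkl (by decide))) <;> assumption
  -- first insert `l`, then `k`, then `j`
  have s3 : ∀ i j k l, i < j → j < k → pfFour A A i j k l = 0 := by
    intro i j k l hij hjk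
    rcases lt_trichotomy k l with h1 | rfl | h1
    · exact sorted _ _ _ _ hij hjk h1
    · exact e34 _ _ _
    rw [swap34, neg_eq_zero]
    rcases lt_trichotomy j l with h2 | rfl | h2
    · exact sorted _ _ _ _ hij h2 h1
    · exact e23 _ _ _
    rw [swap23, neg_eq_zero]
    rcases lt_trichotomy i l with h3 | rfl | h3
    · exact sorted _ _ _ _ h3 h2 hjk
    · exact e12 _ _ _
    rw [swap12, neg_eq_zero]
    exact sorted _ _ _ _ h3 hij hjk
  have s2 : ∀ i j k l, i < j → pfFour A A i j k l = 0 := by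
    intro i j k l hij
    rcases lt_trichotomy j k with h1 | rfl | h1
    · exact s3 _ _ _ _ hij h1
    · exact e23 _ _ _
    rw [swap23, neg_eq_zero]
    rcases lt_trichotomy i k with h2 | rfl | h2
    · exact s3 _ _ _ _ h2 h1
    · exact e12 _ _ _
    rw [swap12, neg_eq_zero]
    exact s3 _ _ _ _ h2 hij
  rcases lt_trichotomy i j with h1 | rfl | h1
  · exact s2 _ _ _ _ h1
  · exact e12 _ _ _
  · rw [swap12, neg_eq_zero]
    exact s2 _ _ _ _ h1

end PfaffianAdjoint
end PfaffianCubic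

namespace PfaffianCubic

open Matrix Module

/-! ### Rank, kernel and pencils of skew matrices. -/

section Skew

/-- Among two linear maps between spaces of the same positive dimension, some nontrivial linear
combination is not injective. -/
theorem exists_pencil_kernel {A B : Type*} [AddCommGroup A] [Module ℂ A] [AddCommGroup B]
    [Module ℂ B] [FiniteDimensional ℂ A] [FiniteDimensional ℂ B] (f g : A →ₗ[ℂ] B)
    (h : finrank ℂ A = finrank ℂ B) (h0 : 0 < finrank ℂ A) :
    ∃ s t : ℂ, (s ≠ 0 ∨ t ≠ 0) ∧ ∃ a : A, a ≠ 0 ∧ s • f a + t • g a = 0 := by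
  by_cases hf : Function.Injective f
  · have : Nontrivial A := finrank_pos_iff.1 h0
    let e := LinearEquiv.ofInjectiveOfFinrankEq f hf h
    obtain ⟨μ, hμ⟩ := Module.End.exists_eigenvalue (e.symm.toLinearMap ∘ₗ g)
    obtain ⟨a, ha⟩ := hμ.exists_hasEigenvector
    refine ⟨-μ, 1, Or.inr one_ne_zero, a, ha.2, ?_⟩
    have h1 : e.symm (g a) = μ • a := ha.apply_eq_smul
    have h2 : g a = μ • f a := by
      rw [LinearEquiv.symm_apply_eq] at h1
      rw [h1, map_smul]
      rfl
    rw [h2]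
    simp
  · have : ¬ LinearMap.ker f = ⊥ := fun h => hf (LinearMap.ker_eq_bot.1 h)
    obtain ⟨a, ha, ha0⟩ := (Submodule.ne_bot_iff _).1 this
    exact ⟨1, 0, Or.inl one_ne_zero, a, ha0, by simp [LinearMap.mem_ker.1 ha]⟩

theorem mem_ker_mulVecLin {n : Type*} [Fintype n] {A : Matrix n n ℂ} {x : n → ℂ} :
    x ∈ LinearMap.ker A.mulVecLin ↔ A *ᵥ x = 0 := Iff.rfl

theorem dotProduct_mulVec_of_transpose {n : Type*} [Fintype n] {A : Matrix n n ℂ} (h : Aᵀ = -A)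
    (x y : n → ℂ) : x ⬝ᵥ A *ᵥ y = -(y ⬝ᵥ A *ᵥ x) := by
  rw [dotProduct_mulVec, ← mulVec_transpose, h, neg_mulVec, neg_dotProduct, dotProduct_comm]

theorem apply_of_transpose {n : Type*} {A : Matrix n n ℂ} (h : Aᵀ = -A) (i j : n) :
    A j i = -A i j := by
  simpa using congrFun (congrFun h i) j

theorem diag_of_transpose {n : Type*} {A : Matrix n n ℂ} (h : Aᵀ = -A) (i : n) : A i i = 0 :=
  self_eq_neg.1 (apply_of_transpose h i i)

/-- If `y` is orthogonal for the skew form `A` to a complement of a space of kernel vectors, then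
`y` lies in the kernel. -/
theorem mulVec_eq_zero_of_isCompl {n : Type*} [Fintype n] {A : Matrix n n ℂ} (h : Aᵀ = -A)
    {K C : Submodule ℂ (n → ℂ)} (hKC : IsCompl K C) (hK : ∀ k ∈ K, A *ᵥ k = 0) {y : n → ℂ}
    (hy : ∀ x ∈ C, x ⬝ᵥ A *ᵥ y = 0) : A *ᵥ y = 0 := by
  refine dotProduct_eq_zero _ fun z => ?_
  obtain ⟨k, hk, x, hx, rfl⟩ := Submodule.mem_sup.1
    (show z ∈ K ⊔ C by rw [hKC.sup_eq_top]; trivial)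
  rw [dotProduct_comm, add_dotProduct, hy x hx, dotProduct_mulVec_of_transpose h, hK k hk]
  simp

/-- A skew-symmetric matrix has even rank. -/
theorem even_finrank_range {n : Type*} [Fintype n] {A : Matrix n n ℂ} (h : Aᵀ = -A) :
    Even (finrank ℂ (LinearMap.range A.mulVecLin)) := by
  obtain ⟨C, hC⟩ := Submodule.exists_isCompl (LinearMap.ker A.mulVecLin)
  have hdim : finrank ℂ (LinearMap.range A.mulVecLin) = finrank ℂ C := by
    have h1 := A.mulVecLin.finrank_range_add_finrank_ker
    have h2 := Submodule.finrank_add_eq_of_isCompl hC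
    omega
  rw [hdim]
  let c := finBasis ℂ C
  -- The Gram matrix on a complement of the kernel is nonsingular, and a skew matrix of odd size has
  -- determinant zero.
  let N : Matrix (Fin (finrank ℂ C)) (Fin (finrank ℂ C)) ℂ :=
    Matrix.of fun i j => (c i : n → ℂ) ⬝ᵥ A *ᵥ (c j : n → ℂ)
  have hN : Nᵀ = -N := by
    ext i j
    simpa [N] using dotProduct_mulVec_of_transpose h (c j : n → ℂ) (c i)
  have hdet : N.det ≠ 0 := by
    intro h0
    obtain ⟨x, hx, hNx⟩ := Matrix.exists_mulVec_eq_zero_iff.2 h0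
    have key : ∀ i, (c i : n → ℂ) ⬝ᵥ A *ᵥ ((∑ j, x j • c j : C) : n → ℂ) = 0 := fun i => by
      have := congrFun hNx i
      rw [mulVec, dotProduct] at this
      simp only [Submodule.coe_sum, Submodule.coe_smul, mulVec_sum, dotProduct_sum, mulVec_smul,
        dotProduct_smul, smul_eq_mul]
      simpa [N, mul_comm] using this
    have hy : A *ᵥ ((∑ j, x j • c j : C) : n → ℂ) = 0 := by
      refine mulVec_eq_zero_of_isCompl h hC (fun k hk => by simpa using hk) fun z hz => ?_
      rw [← Subtype.coe_mk z hz, ← c.sum_repr ⟨z, hz⟩]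
      rw [Submodule.coe_sum, sum_dotProduct]
      exact Finset.sum_eq_zero fun i _ => by
        rw [Submodule.coe_smul, smul_dotProduct, key i, smul_zero]
    have h3 : (∑ j, x j • c j : C) = 0 := by
      have := Submodule.disjoint_def.1 hC.disjoint _ (mem_ker_mulVecLin.2 hy) (∑ j, x j • c j : C).2
      exact Subtype.ext this
    refine hx (funext fun j => ?_)
    exact Fintype.linearIndependent_iff.1 c.linearIndependent x h3 j
  by_contra hodd
  rw [Nat.not_even_iff_odd] at hodd
  have h4 := congrArg Matrix.det hN
  rw [det_transpose, det_neg, Fintype.card_fin, hodd.neg_one_pow, neg_one_mul] at h4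
  exact hdet (self_eq_neg.1 h4)

/-- Two skew forms of rank four on a six-dimensional space with the same kernel span a pencil
which contains a form with larger kernel. -/
theorem eq_smul_of_ker_le {A B : Matrix (Fin 6) (Fin 6) ℂ} (hA : Aᵀ = -A) (hB : Bᵀ = -B)
    (hA2 : finrank ℂ (LinearMap.ker A.mulVecLin) = 2)
    (hAB : LinearMap.ker A.mulVecLin ≤ LinearMap.ker B.mulVecLin)
    (h : ∀ s t : ℂ, s • A + t • B ≠ 0 →
      finrank ℂ (LinearMap.ker (s • A + t • B).mulVecLin) ≤ 2) : ∃ c : ℂ, B = c • A := by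
  obtain ⟨C, hC⟩ := Submodule.exists_isCompl (LinearMap.ker A.mulVecLin)
  have hdim : finrank ℂ C = 4 := by
    have h2 := Submodule.finrank_add_eq_of_isCompl hC
    simp at h2
    omega
  let φ : Matrix (Fin 6) (Fin 6) ℂ → (C →ₗ[ℂ] Dual ℂ C) := fun M =>
    LinearMap.mk₂ ℂ (fun x y => (y : Fin 6 → ℂ) ⬝ᵥ M *ᵥ (x : Fin 6 → ℂ))
      (fun x x' y => by simp [mulVec_add, dotProduct_add])
      (fun r x y => by simp [mulVec_smul]) (fun x y y' => by simp [add_dotProduct])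
      (fun r x y => by simp)
  -- Both forms are determined by their restrictions to the four-dimensional complement C. Some
  -- member of the pencil degenerates on C, so its kernel has dimension greater than 2 and the
  -- hypothesis forces that member to be zero.
  obtain ⟨s, t, hst, a, ha, he⟩ := exists_pencil_kernel (φ A) (φ B)
    (Subspace.dual_finrank_eq).symm (by omega)
  have hskew : (s • A + t • B)ᵀ = -(s • A + t • B) := by
    rw [transpose_add, transpose_smul, transpose_smul, hA, hB]
    simp [add_comm]
  have hKker : ∀ k ∈ LinearMap.ker A.mulVecLin, (s • A + t • B) *ᵥ k = 0 := fun k hk => by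
    have h1 : A *ᵥ k = 0 := by simpa using hk
    have h2 : B *ᵥ k = 0 := by simpa using hAB hk
    simp [add_mulVec, smul_mulVec, h1, h2]
  have hak : (s • A + t • B) *ᵥ (a : Fin 6 → ℂ) = 0 := by
    refine mulVec_eq_zero_of_isCompl hskew hC hKker fun x hx => ?_
    have := LinearMap.congr_fun he ⟨x, hx⟩
    simpa [φ, add_mulVec, smul_mulVec, dotProduct_add] using this
  have hzero : s • A + t • B = 0 := by
    by_contra hne
    have h1 := h s t hne
    have hlt : LinearMap.ker A.mulVecLin < LinearMap.ker (s • A + t • B).mulVecLin := by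
      refine SetLike.lt_iff_le_and_exists.2 ⟨fun k hk => hKker k hk, (a : Fin 6 → ℂ), hak,
        fun h' => ?_⟩
      exact ha (Subtype.ext (Submodule.disjoint_def.1 hC.disjoint _ h' a.2))
    have := Submodule.finrank_lt_finrank_of_lt hlt
    omega
  by_cases ht : t = 0
  · subst ht
    have hs : s ≠ 0 := by simpa using hst
    have hA0 : A = 0 := by simpa [hs] using hzero
    subst hA0
    rw [Matrix.mulVecLin_zero, LinearMap.ker_zero, finrank_top] at hA2
    simp at hA2
  · refine ⟨-(t⁻¹ * s), ?_⟩
    have := congrArg (fun M => t⁻¹ • M) hzero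
    simp only [smul_add, smul_smul, inv_mul_cancel₀ ht, one_smul, smul_zero] at this
    rw [neg_smul]
    exact eq_neg_of_add_eq_zero_right this

/-- A skew-symmetric matrix with vanishing pfaffian adjoint has rank at most two. -/
theorem finrank_range_le_two {A : Matrix (Fin 6) (Fin 6) ℂ} (hA : Aᵀ = -A) (hP : pfAdj A = 0) :
    finrank ℂ (LinearMap.range A.mulVecLin) ≤ 2 := by
  by_cases h0 : A = 0
  · subst h0
    rw [Matrix.mulVecLin_zero, LinearMap.range_zero, finrank_bot]
    omega
  have h1 : ∃ i j, A i j ≠ 0 := by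
    by_contra! h
    exact h0 (by ext i j; exact h i j)
  obtain ⟨i, j, hij⟩ := h1
  have hq := pfFour_eq_zero_of_pfAdj (apply_of_transpose hA) (diag_of_transpose hA) hP
  have hle : LinearMap.range A.mulVecLin ≤ Submodule.span ℂ (Set.range ![A i, A j]) := by
    rw [Matrix.range_mulVecLin, Submodule.span_le]
    rintro _ ⟨l, rfl⟩
    -- The vanishing pfaffian on i, j, k, l is solved for `A k l`; this is possible since `A i j ≠
    -- 0`.
    have : A.col l = ((A i j)⁻¹ * A j l) • A i + (-(A i j)⁻¹ * A i l) • A j := by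
      ext k
      have h2 := hq i j k l
      simp only [pfFour] at h2
      simp only [col_apply, Pi.add_apply, Pi.smul_apply, smul_eq_mul]
      field_simp
      linear_combination h2
    rw [this]
    exact Submodule.add_mem _ (Submodule.smul_mem _ _ (Submodule.subset_span ⟨0, rfl⟩))
      (Submodule.smul_mem _ _ (Submodule.subset_span ⟨1, rfl⟩))
  calc _ ≤ finrank ℂ (Submodule.span ℂ (Set.range ![A i, A j])) := Submodule.finrank_mono hle
    _ ≤ _ := (finrank_range_le_card _).trans (by simp)

/-- The columns of the pfaffian adjoint span the kernel of a skew form of rank four. -/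
theorem range_pfAdj {A : Matrix (Fin 6) (Fin 6) ℂ} (hA : Aᵀ = -A) (hAP : A * pfAdj A = 0)
    (hA2 : finrank ℂ (LinearMap.ker A.mulVecLin) = 2) :
    LinearMap.range (pfAdj A).mulVecLin = LinearMap.ker A.mulVecLin := by
  have hle : LinearMap.range (pfAdj A).mulVecLin ≤ LinearMap.ker A.mulVecLin := by
    rintro _ ⟨x, rfl⟩
    simp [hAP]
  refine Submodule.eq_of_le_of_finrank_le hle ?_
  have h1 := Submodule.finrank_mono hle
  obtain ⟨m, hm⟩ := even_finrank_range (pfBilin_transpose A A)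
  change finrank ℂ (LinearMap.range (pfAdj A).mulVecLin) = m + m at hm
  have h0 : m ≠ 0 := by
    rintro rfl
    have h2 : pfAdj A = 0 := by
      have h2 := LinearMap.range_eq_bot.1 (Submodule.finrank_eq_zero.1 hm)
      rwa [← Matrix.toLin'_apply', LinearEquiv.map_eq_zero_iff] at h2
    have h3 := finrank_range_le_two hA h2
    have h4 := A.mulVecLin.finrank_range_add_finrank_ker
    simp at h4
    omega
  omega

end Skew
end PfaffianCubic

namespace PfaffianCubic

open Matrix Module

/-! ### Linear systems of skew forms evaluated at a general vector. -/

section LinearSystems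

/-- Evaluation at `e` of a linear system `V` of matrices. -/
def evalAt (V : Submodule ℂ (Matrix (Fin 6) (Fin 6) ℂ)) (e : Fin 6 → ℂ) : V →ₗ[ℂ] (Fin 6 → ℂ) :=
  (Matrix.mulVecBilin ℂ ℂ).flip e ∘ₗ V.subtype

@[simp] theorem evalAt_apply (V : Submodule ℂ (Matrix (Fin 6) (Fin 6) ℂ)) (e : Fin 6 → ℂ) (A : V) :
    evalAt V e A = (A : Matrix (Fin 6) (Fin 6) ℂ) *ᵥ e := rfl

/-- If evaluation at `e₀` has the maximal rank, then matrices killing `e₀` have image inside the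
image of evaluation at `e₀`. -/
theorem mulVec_mem_range_evalAt {V : Submodule ℂ (Matrix (Fin 6) (Fin 6) ℂ)} {e₀ : Fin 6 → ℂ}
    (hmin : ∀ e, finrank ℂ (LinearMap.ker (evalAt V e₀)) ≤ finrank ℂ (LinearMap.ker (evalAt V e)))
    {A : Matrix (Fin 6) (Fin 6) ℂ} (hA : A ∈ V) (h : A *ᵥ e₀ = 0) (e : Fin 6 → ℂ) :
    A *ᵥ e ∈ LinearMap.range (evalAt V e₀) := by
  by_contra hnot
  let c := finBasis ℂ (LinearMap.range (evalAt V e₀))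
  choose M hM using fun i => (c i).2
  -- At t = 0 this is a basis of the image of evaluation at e₀ together with the offending vector.
  -- Independence persists for small t.
  let F : ℂ → Fin (finrank ℂ (LinearMap.range (evalAt V e₀)) + 1) → (Fin 6 → ℂ) := fun t =>
    Fin.cons (A *ᵥ e) fun i => (M i : Matrix (Fin 6) (Fin 6) ℂ) *ᵥ (e₀ + t • e)
  have hF0 : LinearIndependent ℂ (F 0) := by
    have e1 : (fun i => (M i : Matrix (Fin 6) (Fin 6) ℂ) *ᵥ (e₀ + (0 : ℂ) • e)) =
        fun i => ((c i : LinearMap.range (evalAt V e₀)) : Fin 6 → ℂ) := by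
      funext i
      rw [zero_smul, add_zero, ← hM i]
      rfl
    have e2 : LinearIndependent ℂ
        fun i => ((c i : LinearMap.range (evalAt V e₀)) : Fin 6 → ℂ) :=
      c.linearIndependent.map' (Submodule.subtype _) (Submodule.ker_subtype _)
    refine linearIndependent_finCons.2 ⟨by rw [e1]; exact e2, fun hmem => hnot ?_⟩
    rw [e1] at hmem
    refine Submodule.span_le.2 ?_ hmem
    rintro _ ⟨i, rfl⟩
    exact (c i).2
  have hcont : Continuous F := by
    refine continuous_pi fun i => ?_
    refine Fin.cases ?_ (fun i => ?_) i
    · exact continuous_const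
    · have : (fun t : ℂ => F t i.succ) = fun t : ℂ =>
          (M i : Matrix (Fin 6) (Fin 6) ℂ) *ᵥ e₀ + t • ((M i : Matrix (Fin 6) (Fin 6) ℂ) *ᵥ e) := by
        funext t
        simp [F, mulVec_add, mulVec_smul]
      rw [this]
      fun_prop
  have hev : ∀ᶠ t in nhds (0 : ℂ), LinearIndependent ℂ (F t) :=
    hcont.continuousAt.eventually (isOpen_setOfPred_linearIndependent.mem_nhds hF0)
  obtain ⟨t, ht, ht0⟩ := ((hev.filter_mono nhdsWithin_le_nhds).and
    (self_mem_nhdsWithin (a := (0 : ℂ)) (s := {0}ᶜ))).exists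
  have ht0 : t ≠ 0 := ht0
  have hmem : ∀ i, F t i ∈ LinearMap.range (evalAt V (e₀ + t • e)) := by
    refine Fin.cases ?_ fun i => ?_
    -- Since A kills e₀, it maps e₀ + te to tAe. So for t ≠ 0 the vector Ae is a value at e₀ + te,
    -- and the rank there exceeds the maximal one.
    · refine ⟨t⁻¹ • ⟨A, hA⟩, ?_⟩
      simp [F, mulVec_add, mulVec_smul, smul_mulVec, h, smul_smul, ht0]
    · exact ⟨M i, rfl⟩
  have hle : finrank ℂ (LinearMap.range (evalAt V e₀)) + 1 ≤
      finrank ℂ (LinearMap.range (evalAt V (e₀ + t • e))) := by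
    have h1 : LinearIndependent ℂ
        fun i => (⟨F t i, hmem i⟩ : LinearMap.range (evalAt V (e₀ + t • e))) :=
      LinearIndependent.of_comp (Submodule.subtype _) ht
    simpa using h1.fintype_card_le_finrank
  have h1 := (evalAt V e₀).finrank_range_add_finrank_ker
  have h2 := (evalAt V (e₀ + t • e)).finrank_range_add_finrank_ker
  have h3 := hmin (e₀ + t • e)
  omega

/-- The kernel of a skew matrix is the orthogonal complement of its image. -/
theorem ker_eq_of_range_eq {A B : Matrix (Fin 6) (Fin 6) ℂ} (hA : Aᵀ = -A) (hB : Bᵀ = -B)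
    (h : LinearMap.range A.mulVecLin = LinearMap.range B.mulVecLin) :
    LinearMap.ker A.mulVecLin ≤ LinearMap.ker B.mulVecLin := by
  intro x hx
  rw [mem_ker_mulVecLin] at hx ⊢
  refine dotProduct_eq_zero _ fun y => ?_
  obtain ⟨z, hz⟩ : B *ᵥ y ∈ LinearMap.range A.mulVecLin := h ▸ ⟨y, rfl⟩
  have hz : A *ᵥ z = B *ᵥ y := hz
  rw [dotProduct_comm, dotProduct_mulVec_of_transpose hB, ← hz, dotProduct_mulVec_of_transpose hA, hx]
  simp

/-- A six-dimensional linear system of skew forms on `ℂ⁶` without forms of rank two contains at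
most one form (up to scalars) killing a general vector. -/
theorem exists_finrank_ker_evalAt_le_one {V : Submodule ℂ (Matrix (Fin 6) (Fin 6) ℂ)}
    (hV : ∀ A ∈ V, Aᵀ = -A) (hK : ∀ A ∈ V, A ≠ 0 → finrank ℂ (LinearMap.ker A.mulVecLin) ≤ 2)
    (h6 : finrank ℂ V = 6) : ∃ e, finrank ℂ (LinearMap.ker (evalAt V e)) ≤ 1 := by
  let f : (Fin 6 → ℂ) → ℕ := fun e => finrank ℂ (LinearMap.ker (evalAt V e))
  let e₀ := Function.argmin f
  have hmin : ∀ e, f e₀ ≤ f e := fun e => Function.argmin_le f e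
  refine ⟨e₀, not_lt.1 fun h2 => ?_⟩
  have hr := (evalAt V e₀).finrank_range_add_finrank_ker
  -- If the kernel of evaluation at e₀ has dimension at least 2, its image has dimension at most 4.
  -- A form in V killing e₀ has image inside it and rank at least 4, so the two images coincide.
  have key : ∀ A ∈ V, A ≠ 0 → A *ᵥ e₀ = 0 →
      LinearMap.range A.mulVecLin = LinearMap.range (evalAt V e₀) ∧
      finrank ℂ (LinearMap.ker A.mulVecLin) = 2 := by
    intro A hA h0 hAe
    have hle : LinearMap.range A.mulVecLin ≤ LinearMap.range (evalAt V e₀) := by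
      rintro _ ⟨e, rfl⟩
      exact mulVec_mem_range_evalAt hmin hA hAe e
    have h1 := Submodule.finrank_mono hle
    have h3 := A.mulVecLin.finrank_range_add_finrank_ker
    have h4 := hK A hA h0
    simp only [finrank_fintype_fun_eq_card, Fintype.card_fin] at h3
    exact ⟨Submodule.eq_of_le_of_finrank_le hle (by omega), by omega⟩
  obtain ⟨A, hA0⟩ := (finrank_pos_iff_exists_ne_zero (R := ℂ)
    (M := LinearMap.ker (evalAt V e₀))).1 (by omega)
  have hA0' : ((A : V) : Matrix (Fin 6) (Fin 6) ℂ) ≠ 0 := fun h => hA0 (Subtype.ext (Subtype.ext h))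
  refine absurd (finrank_le_one A fun B => ?_) (not_le.2 h2)
  by_cases hB0 : B = 0
  · exact ⟨0, by simp [hB0]⟩
  have hB0' : ((B : V) : Matrix (Fin 6) (Fin 6) ℂ) ≠ 0 := fun h => hB0 (Subtype.ext (Subtype.ext h))
  obtain ⟨hAr, hA2⟩ := key _ A.1.2 hA0' A.2
  obtain ⟨hBr, -⟩ := key _ B.1.2 hB0' B.2
  obtain ⟨c, hc⟩ := eq_smul_of_ker_le (hV _ A.1.2) (hV _ B.1.2) hA2
    (ker_eq_of_range_eq (hV _ A.1.2) (hV _ B.1.2) (hAr.trans hBr.symm)) fun s t h =>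
      hK _ (V.add_mem (V.smul_mem _ A.1.2) (V.smul_mem _ B.1.2)) h
  exact ⟨c, Subtype.ext (Subtype.ext hc.symm)⟩

/-- The orthogonal complement for the dot product. -/
def dotOrthogonal (S : Submodule ℂ (Fin 6 → ℂ)) : Submodule ℂ (Fin 6 → ℂ) :=
  S.dualAnnihilator.comap (dotProductEquiv ℂ (Fin 6)).toLinearMap

theorem mem_dotOrthogonal {S : Submodule ℂ (Fin 6 → ℂ)} {x : Fin 6 → ℂ} :
    x ∈ dotOrthogonal S ↔ ∀ y ∈ S, x ⬝ᵥ y = 0 := by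
  simp [dotOrthogonal, Submodule.mem_dualAnnihilator]

theorem finrank_dotOrthogonal (S : Submodule ℂ (Fin 6 → ℂ)) :
    finrank ℂ S + finrank ℂ (dotOrthogonal S) = 6 := by
  have h1 := Subspace.finrank_add_finrank_dualAnnihilator_eq S
  have h2 : finrank ℂ (dotOrthogonal S) = finrank ℂ S.dualAnnihilator :=
    ((dotProductEquiv ℂ (Fin 6)).ofSubmodule' S.dualAnnihilator).finrank_eq
  simp only [finrank_fintype_fun_eq_card, Fintype.card_fin] at h1
  omega

end LinearSystems
end PfaffianCubic

namespace PfaffianCubic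

open Matrix Module

/-! ### Nonexistence of five-dimensional systems of skew forms of constant rank four. -/

section ConstantRank

/-- The polarization of the pfaffian adjoint. -/
def pfPolar (A B : Matrix (Fin 6) (Fin 6) ℂ) : Matrix (Fin 6) (Fin 6) ℂ :=
  pfBilin A B + pfBilin B A

theorem pfAdj_transpose (A : Matrix (Fin 6) (Fin 6) ℂ) : (pfAdj A)ᵀ = -pfAdj A :=
  pfBilin_transpose A A

theorem pfAdj_add (A B : Matrix (Fin 6) (Fin 6) ℂ) :
    pfAdj (A + B) = pfAdj A + pfPolar A B + pfAdj B := by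
  rw [pfAdj, pfBilin_add_left, pfBilin_add_right, pfBilin_add_right, pfPolar, pfAdj, pfAdj]
  abel

theorem pfAdj_smul (c : ℂ) (A : Matrix (Fin 6) (Fin 6) ℂ) : pfAdj (c • A) = c ^ 2 • pfAdj A := by
  rw [pfAdj, pfBilin_smul_left, pfBilin_smul_right, smul_smul, sq, pfAdj]

theorem pfAdj_zero : pfAdj (0 : Matrix (Fin 6) (Fin 6) ℂ) = 0 := by
  simpa using pfAdj_smul 0 0

theorem pfPolar_smul_right (c : ℂ) (A B : Matrix (Fin 6) (Fin 6) ℂ) :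
    pfPolar A (c • B) = c • pfPolar A B := by
  rw [pfPolar, pfBilin_smul_left, pfBilin_smul_right, ← smul_add, pfPolar]

theorem pfPolar_add_right (A B B' : Matrix (Fin 6) (Fin 6) ℂ) :
    pfPolar A (B + B') = pfPolar A B + pfPolar A B' := by
  simp only [pfPolar, pfBilin_add_left, pfBilin_add_right]
  abel

theorem pfPolar_comm (A B : Matrix (Fin 6) (Fin 6) ℂ) : pfPolar A B = pfPolar B A :=
  add_comm _ _

theorem pfAdj_sub (A B : Matrix (Fin 6) (Fin 6) ℂ) :
    pfAdj (A - B) = pfAdj A - pfPolar A B + pfAdj B := by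
  rw [sub_eq_add_neg, pfAdj_add, ← neg_one_smul ℂ B, pfPolar_smul_right, pfAdj_smul]
  simp [sub_eq_add_neg]

variable {V : Submodule ℂ (Matrix (Fin 6) (Fin 6) ℂ)}

/-- In a linear system of degenerate skew forms, all forms vanish on the kernel of any form of
rank four. -/
theorem dotProduct_mulVec_ker_eq_zero (hV : ∀ A ∈ V, Aᵀ = -A) (hP : ∀ A ∈ V, A * pfAdj A = 0)
    {A B : Matrix (Fin 6) (Fin 6) ℂ} (hA : A ∈ V) (hB : B ∈ V)
    (hA2 : finrank ℂ (LinearMap.ker A.mulVecLin) = 2) {x y : Fin 6 → ℂ} (hx : A *ᵥ x = 0)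
    (hy : A *ᵥ y = 0) : x ⬝ᵥ B *ᵥ y = 0 := by
  have hPA : pfAdj A * A = 0 := by
    have := congrArg transpose (hP A hA)
    rw [transpose_mul, hV A hA, pfAdj_transpose] at this
    simpa using this
  have h1 := hP _ (V.add_mem hA hB)
  have h2 := hP _ (V.sub_mem hA hB)
  have hAP := hP A hA
  have hBP := hP B hB
  rw [pfAdj_add] at h1
  rw [pfAdj_sub] at h2
  -- This is the coefficient of t in (A + tB)P(A + tB) = 0, extracted from the values at t = 1 and t
  -- = -1. Multiplying by P(A) on the left gives P(A)BP(A) = 0, and P(A) has image ker A.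
  have h3 : A * pfPolar A B + B * pfAdj A = 0 := by
    have e : (2 : ℂ) • (A * pfPolar A B + B * pfAdj A) =
        (A + B) * (pfAdj A + pfPolar A B + pfAdj B) - (A - B) * (pfAdj A - pfPolar A B + pfAdj B)
          - (2 : ℂ) • (B * pfAdj B) := by
      simp only [two_smul, Matrix.add_mul, Matrix.sub_mul, Matrix.mul_add, Matrix.mul_sub]
      abel
    rw [h1, h2, hBP, smul_zero, sub_zero, sub_zero] at e
    exact (smul_eq_zero.1 e).resolve_left two_ne_zero
  have h4 : pfAdj A * (B * pfAdj A) = 0 := by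
    rw [eq_neg_of_add_eq_zero_right h3, Matrix.mul_neg, ← Matrix.mul_assoc, hPA]
    simp
  rw [← mem_ker_mulVecLin, ← range_pfAdj (hV A hA) hAP hA2] at hx hy
  obtain ⟨u, rfl⟩ := hx
  obtain ⟨v, rfl⟩ := hy
  rw [mulVecLin_apply, mulVecLin_apply, dotProduct_comm, dotProduct_mulVec_of_transpose
    (pfAdj_transpose A), mulVec_mulVec, mulVec_mulVec, Matrix.mul_assoc, h4]
  simp

/-- In a five-dimensional linear system of skew forms of rank four, some two independent forms
have a common kernel vector. -/
theorem exists_common_kernel (hV : ∀ A ∈ V, Aᵀ = -A) (hP : ∀ A ∈ V, A * pfAdj A = 0)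
    (hK : ∀ A ∈ V, A ≠ 0 → finrank ℂ (LinearMap.ker A.mulVecLin) = 2) (h5 : finrank ℂ V = 5) :
    ∃ k : Fin 6 → ℂ, k ≠ 0 ∧ ∃ A ∈ V, ∃ B ∈ V, A *ᵥ k = 0 ∧ B *ᵥ k = 0 ∧
      ∀ s t : ℂ, s • A + t • B = 0 → s = 0 ∧ t = 0 := by
  obtain ⟨⟨A, hA⟩, hA0⟩ := (finrank_pos_iff_exists_ne_zero (R := ℂ) (M := V)).1 (by omega)
  have hA0 : A ≠ 0 := fun h => hA0 (Subtype.ext h)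
  have hA2 := hK A hA hA0
  -- A form found in a complement of ℂA is independent of A, and the complement has dimension 4,
  -- matching the dual of C in the pencil argument.
  obtain ⟨L, hLV, hAL, hL4⟩ : ∃ L : Submodule ℂ (Matrix (Fin 6) (Fin 6) ℂ), L ≤ V ∧ A ∉ L ∧
      finrank ℂ L = 4 := by
    obtain ⟨L, hL⟩ := Submodule.exists_isCompl (ℂ ∙ (⟨A, hA⟩ : V))
    have hne : (⟨A, hA⟩ : V) ≠ 0 := fun h => hA0 (congrArg Subtype.val h)
    refine ⟨L.map V.subtype, Submodule.map_subtype_le V L, fun h => ?_, ?_⟩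
    · obtain ⟨x, hx, rfl⟩ := h
      exact hne (Submodule.disjoint_def.1 hL.disjoint _ (Submodule.mem_span_singleton_self _) hx)
    · rw [Submodule.finrank_map_subtype_eq]
      have := Submodule.finrank_add_eq_of_isCompl hL
      rw [finrank_span_singleton hne] at this
      omega
  obtain ⟨C, hC⟩ := Submodule.exists_isCompl (LinearMap.ker A.mulVecLin)
  have hC4 : finrank ℂ C = 4 := by
    have h2 := Submodule.finrank_add_eq_of_isCompl hC
    simp only [finrank_fintype_fun_eq_card, Fintype.card_fin] at h2
    omega
  let κ := finBasisOfFinrankEq ℂ (LinearMap.ker A.mulVecLin) hA2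
  -- Testing against C suffices for B to kill a vector of ker A, because all forms of V vanish on
  -- ker A × ker A.
  let f : Fin 2 → L →ₗ[ℂ] Dual ℂ C := fun i => LinearMap.mk₂ ℂ
      (fun B y => (y : Fin 6 → ℂ) ⬝ᵥ (B : Matrix (Fin 6) (Fin 6) ℂ) *ᵥ (κ i : Fin 6 → ℂ))
      (fun x x' y => by simp [add_mulVec, dotProduct_add])
      (fun r x y => by simp [smul_mulVec]) (fun x y y' => by simp [add_dotProduct])
      (fun r x y => by simp)
  obtain ⟨s, t, hst, ⟨B, hBL⟩, hB0, hB⟩ := exists_pencil_kernel (A := L) (f 0) (f 1)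
    (by rw [Subspace.dual_finrank_eq, hL4, hC4]) (by omega)
  have hB0 : B ≠ 0 := fun h => hB0 (Subtype.ext h)
  let k := s • κ 0 + t • κ 1
  have hk0 : k ≠ 0 := by
    intro h
    have h1 := Fintype.linearIndependent_iffₛ.1 κ.linearIndependent ![s, t] 0 (by simpa using h)
    have h2 : s = 0 := h1 0
    have h3 : t = 0 := h1 1
    simp [h2, h3] at hst
  have hBk : B *ᵥ (k : Fin 6 → ℂ) = 0 := by
    refine dotProduct_eq_zero _ fun z => ?_
    obtain ⟨x, hx, y, hy, rfl⟩ := Submodule.mem_sup.1 (show z ∈ _ ⊔ C by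
      rw [hC.sup_eq_top]; trivial)
    rw [dotProduct_comm, add_dotProduct, dotProduct_mulVec_ker_eq_zero hV hP hA (hLV hBL) hA2 hx k.2,
      zero_add]
    have := LinearMap.congr_fun hB ⟨y, hy⟩
    simpa [f, k, mulVec_add, mulVec_smul, dotProduct_add] using this
  refine ⟨k, fun h => hk0 (Subtype.ext h), A, hA, B, hLV hBL, k.2, hBk, fun a b hab => ?_⟩
  have ha : a = 0 := by
    by_contra ha
    refine hAL ?_
    have h1 : a • A ∈ L := by
      rw [eq_neg_of_add_eq_zero_left hab]
      exact L.neg_mem (L.smul_mem _ hBL)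
    exact (Submodule.smul_mem_iff _ ha).1 h1
  rw [ha, zero_smul, zero_add] at hab
  exact ⟨ha, (smul_eq_zero.1 hab).resolve_right hB0⟩

variable {k φ : Fin 6 → ℂ}

/-- Write k = P(A)z, as ker A is the image of P(A). By skewness k·φ = -z·P(A)φ, and this is 1. The
vector P(A)φ completes k to a basis of ker A. -/
theorem pfAdj_mulVec_ne_zero (hV : ∀ A ∈ V, Aᵀ = -A) (hP : ∀ A ∈ V, A * pfAdj A = 0)
    (hK : ∀ A ∈ V, A ≠ 0 → finrank ℂ (LinearMap.ker A.mulVecLin) = 2) (hφ : k ⬝ᵥ φ = 1)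
    {A : Matrix (Fin 6) (Fin 6) ℂ} (hA : A ∈ V) (hA0 : A ≠ 0) (hAk : A *ᵥ k = 0) :
    pfAdj A *ᵥ φ ≠ 0 := by
  intro h0
  rw [← mem_ker_mulVecLin, ← range_pfAdj (hV _ hA) (hP _ hA) (hK _ hA hA0)] at hAk
  obtain ⟨z, hz⟩ := hAk
  rw [← hz, mulVecLin_apply, dotProduct_comm, dotProduct_mulVec_of_transpose
    (pfAdj_transpose _), h0] at hφ
  simp at hφ

/-- Two forms of rank four with the same contracted pfaffian adjoint and a common kernel vector
are proportional. -/
theorem eq_smul_of_pfAdj_mulVec_eq (hV : ∀ A ∈ V, Aᵀ = -A) (hP : ∀ A ∈ V, A * pfAdj A = 0)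
    (hK : ∀ A ∈ V, A ≠ 0 → finrank ℂ (LinearMap.ker A.mulVecLin) = 2) (hφ : k ⬝ᵥ φ = 1)
    {A B : Matrix (Fin 6) (Fin 6) ℂ} (hA : A ∈ V) (hB : B ∈ V) (hA0 : A ≠ 0)
    (hAk : A *ᵥ k = 0) (hBk : B *ᵥ k = 0) (h : pfAdj A *ᵥ φ = pfAdj B *ᵥ φ) :
    ∃ c : ℂ, B = c • A := by
  have hA2 := hK _ hA hA0
  have hn0 := pfAdj_mulVec_ne_zero hV hP hK hφ hA hA0 hAk
  have hnA : A *ᵥ pfAdj A *ᵥ φ = 0 := by rw [mulVec_mulVec, hP _ hA, zero_mulVec]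
  have hnB : B *ᵥ pfAdj A *ᵥ φ = 0 := by rw [h, mulVec_mulVec, hP _ hB, zero_mulVec]
  have hnφ : pfAdj A *ᵥ φ ⬝ᵥ φ = 0 := by
    rw [dotProduct_comm]
    exact self_eq_neg.1 (dotProduct_mulVec_of_transpose (pfAdj_transpose _) φ φ)
  generalize pfAdj A *ᵥ φ = n at *
  -- The covector φ vanishes on n but not on k, so n and k span ker A. Both are also killed by B.
  have hind : LinearIndependent ℂ ![n, k] := by
    refine LinearIndependent.pair_iff.2 fun a b hab => ?_
    have h1 := congrArg (· ⬝ᵥ φ) hab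
    simp only [add_dotProduct, smul_dotProduct, hnφ, hφ, zero_dotProduct, smul_eq_mul, mul_one,
      mul_zero, zero_add] at h1
    rw [h1, zero_smul, add_zero] at hab
    exact ⟨(smul_eq_zero.1 hab).resolve_right hn0, h1⟩
  have hspan := finrank_span_eq_card hind
  rw [Fintype.card_fin] at hspan
  have hXs : Submodule.span ℂ (Set.range ![n, k]) = LinearMap.ker A.mulVecLin := by
    refine Submodule.eq_of_le_of_finrank_le (Submodule.span_le.2 ?_) (by omega)
    rintro _ ⟨i, rfl⟩
    fin_cases i
    · exact hnA
    · exact hAk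
  refine eq_smul_of_ker_le (hV _ hA) (hV _ hB) hA2 ?_ fun s t h =>
    (hK _ (V.add_mem (V.smul_mem _ hA) (V.smul_mem _ hB)) h).le
  rw [← hXs]
  refine Submodule.span_le.2 ?_
  rintro _ ⟨i, rfl⟩
  fin_cases i
  · exact hnB
  · exact hBk

/-- If the polar form vanished, A + B and A - B would have the same contracted adjoint and hence be
proportional. The adjoint is quadratic, so the ratio is 1 or -1, forcing B = 0 or A = 0. -/
theorem pfPolar_mulVec_ne_zero (hV : ∀ A ∈ V, Aᵀ = -A) (hP : ∀ A ∈ V, A * pfAdj A = 0)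
    (hK : ∀ A ∈ V, A ≠ 0 → finrank ℂ (LinearMap.ker A.mulVecLin) = 2) (hφ : k ⬝ᵥ φ = 1)
    {A B : Matrix (Fin 6) (Fin 6) ℂ} (hA : A ∈ V) (hB : B ∈ V) (hA0 : A ≠ 0) (hB0 : B ≠ 0)
    (hAk : A *ᵥ k = 0) (hBk : B *ᵥ k = 0) : pfPolar A B *ᵥ φ ≠ 0 := by
  intro hAB
  have heq : pfAdj (A + B) *ᵥ φ = pfAdj (A - B) *ᵥ φ := by
    rw [pfAdj_add, pfAdj_sub, add_mulVec, add_mulVec, add_mulVec, sub_mulVec, hAB, sub_zero,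
      add_zero]
  have hXV := V.add_mem hA hB
  have hYV := V.sub_mem hA hB
  have hXk : (A + B) *ᵥ k = 0 := by rw [add_mulVec, hAk, hBk, add_zero]
  have hYk : (A - B) *ᵥ k = 0 := by rw [sub_mulVec, hAk, hBk, sub_zero]
  have two : ∀ x : Matrix (Fin 6) (Fin 6) ℂ, x + x = 0 → x = 0 := fun x hx => by
    rw [← two_smul ℂ x] at hx
    exact (smul_eq_zero.1 hx).resolve_left two_ne_zero
  have hX0 : A + B ≠ 0 := fun h => by
    have h1 : A - B ≠ 0 := fun h' => hA0 (two _ (by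
      calc A + A = (A + B) + (A - B) := by abel
        _ = 0 := by rw [h, h', add_zero]))
    refine pfAdj_mulVec_ne_zero hV hP hK hφ hYV h1 hYk ?_
    rw [← heq, h, pfAdj_zero, zero_mulVec]
  obtain ⟨c, hc⟩ := eq_smul_of_pfAdj_mulVec_eq hV hP hK hφ hXV hYV hX0 hXk hYk heq
  have hc2 : c ^ 2 = 1 := by
    rw [hc, pfAdj_smul, smul_mulVec] at heq
    have h2 : (c ^ 2 - 1) • (pfAdj (A + B) *ᵥ φ) = 0 := by
      rw [sub_smul, one_smul, ← heq, sub_self]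
    exact sub_eq_zero.1 ((smul_eq_zero.1 h2).resolve_right
      (pfAdj_mulVec_ne_zero hV hP hK hφ hXV hX0 hXk))
  rcases sq_eq_sq_iff_eq_or_eq_neg.1 (hc2.trans (one_pow 2).symm) with rfl | rfl
  · refine hB0 (two _ ?_)
    rw [one_smul] at hc
    calc B + B = (A + B) - (A - B) := by abel
      _ = 0 := by rw [hc, sub_self]
  · refine hA0 (two _ ?_)
    calc A + A = (A + B) + (A - B) := by abel
      _ = 0 := by rw [hc, neg_smul, one_smul, add_neg_cancel]

/-- There is no five-dimensional linear system of skew forms on `ℂ⁶` all of whose nonzero members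
have rank four. -/
theorem finrank_ne_five_of_rank_four (hV : ∀ A ∈ V, Aᵀ = -A) (hP : ∀ A ∈ V, A * pfAdj A = 0)
    (hK : ∀ A ∈ V, A ≠ 0 → finrank ℂ (LinearMap.ker A.mulVecLin) = 2) : finrank ℂ V ≠ 5 := by
  intro h5
  obtain ⟨k, hk0, A₁, hA₁, A₂, hA₂, hk₁, hk₂, hind⟩ := exists_common_kernel hV hP hK h5
  obtain ⟨φ, hφ⟩ : ∃ φ : Fin 6 → ℂ, k ⬝ᵥ φ = 1 := by
    obtain ⟨i, hi⟩ := Function.ne_iff.1 hk0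
    exact ⟨Pi.single i (k i)⁻¹, by simpa using mul_inv_cancel₀ hi⟩
  let T := (LinearMap.ker (evalAt V k)).map V.subtype
  have memT : ∀ {A}, A ∈ T ↔ A ∈ V ∧ A *ᵥ k = 0 := by
    intro A
    constructor
    · rintro ⟨B, hB, rfl⟩
      exact ⟨B.2, hB⟩
    · rintro ⟨h1, h2⟩
      exact ⟨⟨A, h1⟩, h2, rfl⟩
  let R := LinearMap.range (evalAt V k)
  -- R has dimension 5 - dim T and does not contain φ, because it is orthogonal to k. So dim S = 6 -
  -- (5 - dim T) - 1 = dim T, which is what the pencil argument needs.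
  let S := dotOrthogonal (R ⊔ (ℂ ∙ φ))
  have hS : finrank ℂ T = finrank ℂ S := by
    have hφ0 : φ ≠ 0 := by
      rintro rfl
      simp at hφ
    have hd : R ⊓ (ℂ ∙ φ) = ⊥ := by
      refine (Submodule.eq_bot_iff _).2 fun x hx => ?_
      obtain ⟨⟨A, hA⟩, rfl⟩ := (Submodule.mem_inf.1 hx).1
      obtain ⟨c, hc⟩ := Submodule.mem_span_singleton.1 (Submodule.mem_inf.1 hx).2
      have h1 : k ⬝ᵥ A *ᵥ k = 0 := self_eq_neg.1 (dotProduct_mulVec_of_transpose (hV _ hA) k k)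
      rw [evalAt_apply] at hc
      rw [← hc, dotProduct_smul, hφ, smul_eq_mul, mul_one] at h1
      rw [evalAt_apply, ← hc, h1, zero_smul]
    have h1 := Submodule.finrank_sup_add_finrank_inf_eq R (ℂ ∙ φ)
    rw [hd, finrank_bot, finrank_span_singleton hφ0] at h1
    have h2 := finrank_dotOrthogonal (R ⊔ (ℂ ∙ φ))
    have h3 := (evalAt V k).finrank_range_add_finrank_ker
    have h4 : finrank ℂ T = _ := Submodule.finrank_map_subtype_eq V (LinearMap.ker (evalAt V k))
    change _ = finrank ℂ (dotOrthogonal _)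
    change finrank ℂ R + _ = _ at h3
    omega
  have hmemP : ∀ A ∈ T, pfAdj A *ᵥ φ ∈ S := by
    intro A hA
    obtain ⟨hAV, hAk⟩ := memT.1 hA
    refine mem_dotOrthogonal.2 fun y hy => ?_
    obtain ⟨r, ⟨B, rfl⟩, x, hx, rfl⟩ := Submodule.mem_sup.1 hy
    obtain ⟨c, rfl⟩ := Submodule.mem_span_singleton.1 hx
    have h1 : φ ⬝ᵥ pfAdj A *ᵥ φ = 0 :=
      self_eq_neg.1 (dotProduct_mulVec_of_transpose (pfAdj_transpose _) φ φ)
    rw [dotProduct_comm, add_dotProduct, smul_dotProduct, h1, smul_zero, add_zero, dotProduct_comm]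
    by_cases hA0 : A = 0
    · rw [hA0, pfAdj_zero]
      simp
    -- Both P(A)φ and k lie in ker A, on which every form B of V vanishes.
    · refine dotProduct_mulVec_ker_eq_zero hV hP hAV B.2 (hK _ hAV hA0) ?_ hAk
      rw [mulVec_mulVec, hP _ hAV, zero_mulVec]
  have hpol : ∀ A ∈ T, ∀ B ∈ T, pfPolar A B *ᵥ φ ∈ S := by
    intro A hA B hB
    have h2 := S.sub_mem (S.sub_mem (hmemP _ (T.add_mem hA hB)) (hmemP A hA)) (hmemP B hB)
    convert h2 using 1
    rw [← sub_mulVec, ← sub_mulVec, pfAdj_add]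
    congr 1
    abel
  let f : T → T →ₗ[ℂ] S := fun B =>
    { toFun := fun A => ⟨pfPolar B.1 A.1 *ᵥ φ, hpol _ B.2 _ A.2⟩
      map_add' := fun A B => Subtype.ext (by simp [pfPolar_add_right, add_mulVec])
      map_smul' := fun r A => Subtype.ext (by simp [pfPolar_smul_right, smul_mulVec]) }
  have hA₁0 : A₁ ≠ 0 := by
    rintro rfl
    simpa using hind 1 0
  have hpos : 0 < finrank ℂ T := (finrank_pos_iff_exists_ne_zero (R := ℂ) (M := T)).2
    ⟨⟨A₁, memT.2 ⟨hA₁, hk₁⟩⟩, fun h => hA₁0 (congrArg Subtype.val h)⟩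
  -- This yields A ≠ 0 in T and sA₁ + tA₂ ≠ 0 whose contracted polar form vanishes, contradicting
  -- `pfPolar_mulVec_ne_zero`.
  obtain ⟨s, t, hst, ⟨A, hA⟩, hA0, he⟩ := exists_pencil_kernel (A := T)
    (f ⟨A₁, memT.2 ⟨hA₁, hk₁⟩⟩) (f ⟨A₂, memT.2 ⟨hA₂, hk₂⟩⟩) hS hpos
  refine pfPolar_mulVec_ne_zero hV hP hK hφ (memT.1 hA).1
    (V.add_mem (V.smul_mem s hA₁) (V.smul_mem t hA₂)) (fun h => hA0 (Subtype.ext h)) (fun h => ?_)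
    (memT.1 hA).2 (by rw [add_mulVec, smul_mulVec, smul_mulVec, hk₁, hk₂]; simp) ?_
  · obtain ⟨rfl, rfl⟩ := hind s t h
    simp at hst
  · have h1 : s • (pfPolar A₁ A *ᵥ φ) + t • (pfPolar A₂ A *ᵥ φ) = 0 := congrArg Subtype.val he
    rw [pfPolar_add_right, pfPolar_smul_right, pfPolar_smul_right, add_mulVec, smul_mulVec,
      smul_mulVec, pfPolar_comm, pfPolar_comm A]
    exact h1

end ConstantRank
end PfaffianCubic

namespace PfaffianCubic

open Matrix Module

/-! ### Irreducibility of the pfaffian cubic. -/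

section Hypersurface

theorem pf_eq_zero_of_mulVec_eq_zero {A : Matrix (Fin 6) (Fin 6) ℂ} (hA : Aᵀ = -A) {e : Fin 6 → ℂ}
    (he : e ≠ 0) (h : A *ᵥ e = 0) : pf A = 0 := by
  have h1 := mul_pfAdj (apply_of_transpose hA) (diag_of_transpose hA)
  have h2 : e ᵥ* (A * pfAdj A) = 0 := by
    rw [← vecMul_vecMul, ← mulVec_transpose A, hA, neg_mulVec, h]
    simp
  rw [h1, vecMul_smul, vecMul_one] at h2
  exact (smul_eq_zero.1 h2).resolve_right he

/-- An invertible A would have zero adjoint, hence rank at most 2. So the kernel is nonzero, and its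
dimension is even because the rank is. -/
theorem finrank_ker_eq_two {A : Matrix (Fin 6) (Fin 6) ℂ} (hA : Aᵀ = -A)
    (hK : finrank ℂ (LinearMap.ker A.mulVecLin) ≤ 2) (h : A * pfAdj A = 0) :
    finrank ℂ (LinearMap.ker A.mulVecLin) = 2 := by
  have h1 := A.mulVecLin.finrank_range_add_finrank_ker
  simp only [finrank_fintype_fun_eq_card, Fintype.card_fin] at h1
  obtain ⟨m, hm⟩ := even_finrank_range hA
  have h0 : finrank ℂ (LinearMap.ker A.mulVecLin) ≠ 0 := by
    intro h0
    have hbot := Submodule.finrank_eq_zero.1 h0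
    have hP : pfAdj A = 0 := by
      have h2 : (pfAdj A).mulVecLin = 0 := by
        refine LinearMap.ext fun x => ?_
        have : (pfAdj A).mulVecLin x ∈ LinearMap.ker A.mulVecLin := by
          rw [mem_ker_mulVecLin, mulVecLin_apply, mulVec_mulVec, h, zero_mulVec]
        rw [hbot] at this
        simpa using this
      rwa [← Matrix.toLin'_apply', LinearEquiv.map_eq_zero_iff] at h2
    have := finrank_range_le_two hA hP
    omega
  omega

variable {v : Fin 6 → Matrix (Fin 6) (Fin 6) ℂ}

/-- The linear combination of the matrices `v i` with coefficients `x`. -/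
def linComb (v : Fin 6 → Matrix (Fin 6) (Fin 6) ℂ) (x : Fin 6 → ℂ) : Matrix (Fin 6) (Fin 6) ℂ :=
  ∑ k, x k • v k

/-- The generic linear combination of the matrices `v i`. -/
noncomputable def genericComb (v : Fin 6 → Matrix (Fin 6) (Fin 6) ℂ) :
    Matrix (Fin 6) (Fin 6) (MvPolynomial (Fin 6) ℂ) :=
  Matrix.of fun i j => ∑ k, MvPolynomial.X k * MvPolynomial.C (v k i j)

theorem eval_genericComb (x : Fin 6 → ℂ) (i j : Fin 6) :
    MvPolynomial.eval x (genericComb v i j) = linComb v x i j := by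
  simp [genericComb, linComb, Matrix.sum_apply]

/-- The pfaffian cubic form. -/
noncomputable def pfForm (v : Fin 6 → Matrix (Fin 6) (Fin 6) ℂ) : MvPolynomial (Fin 6) ℂ :=
  pf (genericComb v)

theorem eval_pfForm (x : Fin 6 → ℂ) : MvPolynomial.eval x (pfForm v) = pf (linComb v x) := by
  simp only [pfForm, pf, map_add, map_sub, map_mul, eval_genericComb]

theorem pfForm_isHomogeneous : (pfForm v).IsHomogeneous 3 := by
  have h : ∀ i j, (genericComb v i j).IsHomogeneous 1 := fun i j => by
    rw [genericComb, Matrix.of_apply]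
    exact MvPolynomial.IsHomogeneous.sum _ _ _ fun k _ => by
      simpa using (MvPolynomial.isHomogeneous_X ℂ k).mul (MvPolynomial.isHomogeneous_C _ (v k i j))
  have h2 : ∀ a b c d, (genericComb v a b * genericComb v c d).IsHomogeneous 2 := fun a b c d =>
    (h a b).mul (h c d)
  have h3 : ∀ (a b) (p : MvPolynomial (Fin 6) ℂ), p.IsHomogeneous 2 →
      (genericComb v a b * p).IsHomogeneous 3 := fun a b p hp => (h a b).mul hp
  have h4 : ∀ a b c d e f g i j k l m, (genericComb v a b * genericComb v c d -
      genericComb v e f * genericComb v g i + genericComb v j k * genericComb v l m).IsHomogeneous 2 :=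
    fun a b c d e f g i j k l m => ((h2 _ _ _ _).sub (h2 _ _ _ _)).add (h2 _ _ _ _)
  exact ((((h3 _ _ _ (h4 _ _ _ _ _ _ _ _ _ _ _ _)).sub (h3 _ _ _ (h4 _ _ _ _ _ _ _ _ _ _ _ _))).add
    (h3 _ _ _ (h4 _ _ _ _ _ _ _ _ _ _ _ _))).sub (h3 _ _ _ (h4 _ _ _ _ _ _ _ _ _ _ _ _))).add
    (h3 _ _ _ (h4 _ _ _ _ _ _ _ _ _ _ _ _))

/-- The pfaffian does not vanish on a hyperplane of a linear system without forms of rank two. -/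
theorem exists_pf_ne_zero (hli : LinearIndependent ℂ v) (hv : ∀ i, (v i)ᵀ = -v i)
    (hK : ∀ x, linComb v x ≠ 0 → finrank ℂ (LinearMap.ker (linComb v x).mulVecLin) ≤ 2)
    {c : Fin 6 → ℂ} (hc : c ≠ 0) : ∃ x, c ⬝ᵥ x = 0 ∧ pf (linComb v x) ≠ 0 := by
  by_contra! h
  have hskew : ∀ x, (linComb v x)ᵀ = -linComb v x := fun x => by
    simp [linComb, Matrix.transpose_sum, hv]
  have hP : ∀ x, c ⬝ᵥ x = 0 → linComb v x * pfAdj (linComb v x) = 0 := fun x hx => by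
    rw [mul_pfAdj (apply_of_transpose (hskew x)) (diag_of_transpose (hskew x)), h x hx, zero_smul]
  let f : (Fin 6 → ℂ) →ₗ[ℂ] Matrix (Fin 6) (Fin 6) ℂ := Fintype.linearCombination ℂ v
  have hf : ∀ x, f x = linComb v x := fun x => by
    simp [f, Fintype.linearCombination_apply, linComb]
  have hfi : Function.Injective f := by
    exact linearIndependent_iff_injective_fintypeLinearCombination.1 hli
  let H := dotOrthogonal (ℂ ∙ c)
  have hH : ∀ x ∈ H, c ⬝ᵥ x = 0 := fun x hx => by
    rw [dotProduct_comm]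
    exact mem_dotOrthogonal.1 hx c (Submodule.mem_span_singleton_self c)
  -- A hyperplane inside the cubic is a five-dimensional system of degenerate nonzero forms, all of
  -- rank 4.
  refine finrank_ne_five_of_rank_four (V := H.map f) ?_ ?_ ?_ ?_
  · rintro _ ⟨x, hx, rfl⟩
    rw [hf, hskew]
  · rintro _ ⟨x, hx, rfl⟩
    rw [hf, hP x (hH x hx)]
  · rintro _ ⟨x, hx, rfl⟩ h0
    rw [hf] at h0 ⊢
    exact finrank_ker_eq_two (hskew x) (hK x h0) (hP x (hH x hx))
  · rw [(Submodule.equivMapOfInjective f hfi H).finrank_eq.symm]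
    have h1 := finrank_dotOrthogonal (ℂ ∙ c)
    rw [finrank_span_singleton hc] at h1
    change finrank ℂ (dotOrthogonal _) = _
    omega

theorem pfForm_ne_zero (hli : LinearIndependent ℂ v) (hv : ∀ i, (v i)ᵀ = -v i)
    (hK : ∀ x, linComb v x ≠ 0 → finrank ℂ (LinearMap.ker (linComb v x).mulVecLin) ≤ 2) :
    pfForm v ≠ 0 := by
  intro h
  obtain ⟨x, -, hx⟩ := exists_pf_ne_zero hli hv hK (c := 1) one_ne_zero
  rw [← eval_pfForm, h, map_zero] at hx
  exact hx rfl

/-- A factor of total degree one of a cubic form gives a hyperplane on which the form vanishes. -/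
theorem exists_eval_eq_zero_of_mul {F G H : MvPolynomial (Fin 6) ℂ} (hF : F.IsHomogeneous 3)
    (hFGH : F = G * H) (hG : G.totalDegree = 1) (hH : H.totalDegree ≤ 2) :
    ∃ c : Fin 6 → ℂ, c ≠ 0 ∧ ∀ x, c ⬝ᵥ x = 0 → MvPolynomial.eval x F = 0 := by
  have hmem : MvPolynomial.homogeneousComponent 1 G ∈ Submodule.span ℂ
      (Set.range (MvPolynomial.X : Fin 6 → MvPolynomial (Fin 6) ℂ)) := by
    rw [← MvPolynomial.homogeneousSubmodule_one_eq_span_X]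
    exact MvPolynomial.homogeneousComponent_mem 1 G
  obtain ⟨c, hc⟩ := (Submodule.mem_span_range_iff_exists_fun ℂ).1 hmem
  have hGsum : G = MvPolynomial.C (G.coeff 0) + ∑ i, c i • MvPolynomial.X i := by
    rw [hc, ← MvPolynomial.homogeneousComponent_zero]
    conv_lhs => rw [← MvPolynomial.sum_homogeneousComponent G, hG]
    simp [Finset.sum_range_succ]
  refine ⟨c, ?_, fun x hx => ?_⟩
  · rintro rfl
    rw [hGsum] at hG
    simp at hG
  -- Restrict to the line t ↦ tx with x in the zero set of the linear part of G. There G is constant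
  -- and H has degree at most 2, while F becomes F(x)t³, so F(x) = 0. The factors need not be
  -- homogeneous.
  let φ : MvPolynomial (Fin 6) ℂ →ₐ[ℂ] Polynomial ℂ :=
    MvPolynomial.aeval fun i => Polynomial.C (x i) * Polynomial.X
  have hφG : φ G = Polynomial.C (G.coeff 0) := by
    conv_lhs => rw [hGsum]
    have : ∑ i, c i • (Polynomial.C (x i) * Polynomial.X) =
        (Polynomial.C (c ⬝ᵥ x) * Polynomial.X : Polynomial ℂ) := by
      simp [dotProduct, map_sum, Finset.sum_mul, Polynomial.smul_eq_C_mul, mul_assoc]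
    simp [φ, this, hx]
  have hφH : (φ H).natDegree ≤ 2 := by
    have := MvPolynomial.aeval_natDegree_le H hH (fun i => Polynomial.C (x i) * Polynomial.X)
      (n := 1) fun i => (Polynomial.natDegree_C_mul_le _ _).trans Polynomial.natDegree_X_le
    simpa using this
  have hφF : φ F = Polynomial.C (MvPolynomial.eval x F) * Polynomial.X ^ 3 := by
    refine Polynomial.funext fun t => ?_
    have h1 := ClassicalAG.eval_scale (w := fun _ : Fin 6 => (1 : ℕ)) hF (powersHom ℂ t) x
    simp only [powersHom_apply, toAdd_ofAdd, pow_one] at h1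
    have h2 : Polynomial.eval t (φ F) = MvPolynomial.eval (fun i => t * x i) F := by
      rw [← Polynomial.coe_evalRingHom, ← RingHom.coe_coe φ, ← RingHom.comp_apply]
      have : (Polynomial.evalRingHom t).comp (φ : MvPolynomial (Fin 6) ℂ →+* Polynomial ℂ) =
          MvPolynomial.eval (fun i => t * x i) := by
        refine MvPolynomial.ringHom_ext (fun r => by simp [φ]) fun i => ?_
        simpa [φ] using mul_comm _ _
      rw [this]
    rw [h2, h1, Polynomial.eval_C_mul, Polynomial.eval_pow, Polynomial.eval_X, mul_comm]
  have h3 : (φ F).natDegree ≤ 2 := by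
    rw [hFGH, map_mul, hφG]
    exact (Polynomial.natDegree_C_mul_le _ _).trans hφH
  by_contra hne
  rw [hφF, Polynomial.natDegree_C_mul_X_pow _ _ hne] at h3
  omega

/-- In a factorization of a cubic, one factor has degree 0 or 1. Degree 0 means a unit, and degree 1
would put a hyperplane into the cubic. -/
theorem pfForm_irreducible (hli : LinearIndependent ℂ v) (hv : ∀ i, (v i)ᵀ = -v i)
    (hK : ∀ x, linComb v x ≠ 0 → finrank ℂ (LinearMap.ker (linComb v x).mulVecLin) ≤ 2) :
    Irreducible (pfForm v) := by
  have hF0 := pfForm_ne_zero hli hv hK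
  have hdeg := pfForm_isHomogeneous.totalDegree hF0
  have hone : ∀ G H : MvPolynomial (Fin 6) ℂ, pfForm v = G * H → G.totalDegree = 1 →
      H.totalDegree ≤ 2 → False := fun G H h hG hH => by
    obtain ⟨c, hc0, hc⟩ := exists_eval_eq_zero_of_mul pfForm_isHomogeneous h hG hH
    obtain ⟨x, hx, hne⟩ := exists_pf_ne_zero hli hv hK hc0
    exact hne (by rw [← eval_pfForm, hc x hx])
  refine ⟨fun h => ?_, fun G H h => ?_⟩
  · have := (MvPolynomial.isUnit_iff_totalDegree_of_isReduced.1 h).2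
    omega
  · have hG0 : G ≠ 0 := by
      rintro rfl
      exact hF0 (by rw [h, zero_mul])
    have hH0 : H ≠ 0 := by
      rintro rfl
      exact hF0 (by rw [h, mul_zero])
    have hsum := MvPolynomial.totalDegree_mul_of_isDomain hG0 hH0
    rw [← h, hdeg] at hsum
    have hunit : ∀ P : MvPolynomial (Fin 6) ℂ, P ≠ 0 → P.totalDegree = 0 → IsUnit P :=
      fun P hP hd => by
        rw [MvPolynomial.totalDegree_eq_zero_iff_eq_C] at hd
        rw [hd]
        refine IsUnit.map _ (isUnit_iff_ne_zero.2 fun h0 => hP ?_)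
        rw [hd, h0, map_zero]
    rcases (by omega : G.totalDegree = 0 ∨ G.totalDegree = 1 ∨ H.totalDegree = 0 ∨
      H.totalDegree = 1) with h' | h' | h' | h'
    · exact Or.inl (hunit G hG0 h')
    · exact (hone G H h h' (by omega)).elim
    · exact Or.inr (hunit H hH0 h')
    · exact (hone H G (by rw [h, mul_comm]) h' (by omega)).elim

/-- Irreducibility of the affine cone over X, as the meeting of two nonempty principal open sets.
The ideal of an irreducible polynomial is prime, so by the Nullstellensatz a product vanishing on
the cone has a factor vanishing on it. -/
theorem exists_pf_eq_zero (hli : LinearIndependent ℂ v) (hv : ∀ i, (v i)ᵀ = -v i)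
    (hK : ∀ x, linComb v x ≠ 0 → finrank ℂ (LinearMap.ker (linComb v x).mulVecLin) ≤ 2)
    {p q : MvPolynomial (Fin 6) ℂ} {x y : Fin 6 → ℂ} (hx : pf (linComb v x) = 0)
    (hpx : MvPolynomial.eval x p ≠ 0) (hy : pf (linComb v y) = 0)
    (hqy : MvPolynomial.eval y q ≠ 0) :
    ∃ z, pf (linComb v z) = 0 ∧ MvPolynomial.eval z p ≠ 0 ∧ MvPolynomial.eval z q ≠ 0 := by
  by_contra! hcon
  have hprime : (Ideal.span {pfForm v}).IsPrime :=
    (Ideal.span_singleton_prime (pfForm_irreducible hli hv hK).ne_zero).2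
      (pfForm_irreducible hli hv hK).prime
  have hmem : ∀ z : Fin 6 → ℂ, z ∈ MvPolynomial.zeroLocus ℂ (Ideal.span {pfForm v}) ↔
      pf (linComb v z) = 0 := fun z => by
    rw [MvPolynomial.zeroLocus_span]
    simp [eval_pfForm, MvPolynomial.aeval_eq_eval]
  have key : p * q ∈ Ideal.span {pfForm v} := by
    rw [← MvPolynomial.IsPrime.vanishingIdeal_zeroLocus (K := ℂ) (Ideal.span {pfForm v}),
      MvPolynomial.mem_vanishingIdeal_iff]
    intro z hz
    rw [hmem] at hz
    by_cases h : MvPolynomial.eval z p = 0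
    · simp [MvPolynomial.aeval_eq_eval, h]
    · simp [MvPolynomial.aeval_eq_eval, hcon z hz h]
  have hvan : ∀ r ∈ Ideal.span {pfForm v}, ∀ z, pf (linComb v z) = 0 →
      MvPolynomial.eval z r = 0 := fun r hr z hz => by
    obtain ⟨s, rfl⟩ := Ideal.mem_span_singleton.1 hr
    rw [map_mul, eval_pfForm, hz, zero_mul]
  rcases hprime.mem_or_mem key with h | h
  · exact hpx (hvan _ h _ hx)
  · exact hqy (hvan _ h _ hy)

end Hypersurface
end PfaffianCubic

/-! ### Morphisms given locally by forms. -/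

namespace ClassicalAG

open TopologicalSpace MvPolynomial SpaceWithFunctions
open scoped LinearAlgebra.Projectivization

universe u v

namespace SpaceWithFunctions

section Forms

variable {X : Type u} {M : Type} [AddCommMonoid M] (Γ : M → Submodule ℂ (X → ℂ))
  [SetLike.GradedMonoid Γ]

theorem isOpen_ne_zero {m : M} {f : X → ℂ} (hf : f ∈ Γ m) :
    IsOpen ({x | f x ≠ 0} : Set (ofForms Γ)) :=
  isOpen_generateFrom_of_mem ⟨m, f, hf, rfl⟩

/-- Forms are closed under products, so their nonvanishing loci are a basis of the topology and not
only a subbasis. -/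
theorem exists_form_subset {O : Set (ofForms Γ)} (hO : IsOpen O) {x : ofForms Γ} (hx : x ∈ O) :
    ∃ (m : M) (f : X → ℂ), f ∈ Γ m ∧ f x ≠ 0 ∧ ∀ y : X, f y ≠ 0 → y ∈ O := by
  change GenerateOpen {U : Set X | ∃ (m : M) (f : X → ℂ), f ∈ Γ m ∧ U = {x | f x ≠ 0}} O at hO
  induction hO with
  | basic s hs =>
    obtain ⟨m, f, hf, rfl⟩ := hs
    exact ⟨m, f, hf, hx, fun y hy => hy⟩
  | univ => exact ⟨0, 1, SetLike.one_mem_graded Γ, one_ne_zero, fun y _ => trivial⟩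
  | inter s t _ _ hs ht =>
    obtain ⟨m, f, hf, hfx, h1⟩ := hs hx.1
    obtain ⟨n, g, hg, hgx, h2⟩ := ht hx.2
    exact ⟨m + n, f * g, SetLike.mul_mem_graded hf hg, mul_ne_zero hfx hgx, fun y hy =>
      ⟨h1 y (left_ne_zero_of_mul hy), h2 y (right_ne_zero_of_mul hy)⟩⟩
  | sUnion S _ hS =>
    obtain ⟨s, hs, hxs⟩ := hx
    obtain ⟨m, f, hf, hfx, h1⟩ := hS s hs hxs
    exact ⟨m, f, hf, hfx, fun y hy => ⟨s, hs, h1 y hy⟩⟩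

theorem div_mem_reg {U : Opens (ofForms Γ)} {m : M} {a b : X → ℂ} (ha : a ∈ Γ m) (hb : b ∈ Γ m)
    (h : ∀ y ∈ U, b y ≠ 0) : (fun y : U => a y.1 / b y.1) ∈ (ofForms Γ).reg U :=
  fun x => ⟨U, m, a, b, ha, hb, x.2, fun y _ => ⟨h y.1 y.2, rfl⟩⟩

variable {Y : Type v} {M' : Type} [AddCommMonoid M'] (Δ : M' → Submodule ℂ (Y → ℂ))
  [SetLike.GradedMonoid Δ]

/-- A map which locally pulls forms back to forms, up to nonvanishing factors depending only on
the degree, is a morphism. -/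
theorem isMorphism_of_forms {Z : Set (ofForms Γ)} (f : (ofForms Γ).restrict Z → ofForms Δ)
    (h : ∀ x : (ofForms Γ).restrict Z, ∃ N : Opens (ofForms Γ), x.1 ∈ N ∧ ∀ m : M', ∃ (n : M)
      (c : (ofForms Γ).restrict Z → ℂ), (∀ y, c y ≠ 0) ∧ ∀ a ∈ Δ m, ∃ a' ∈ Γ n,
        ∀ y : (ofForms Γ).restrict Z, y.1 ∈ N → a (f y) = c y * a' y.1) : IsMorphism f := by
  have hcont : Continuous f := by
    refine continuous_generateFrom_iff.2 ?_
    rintro _ ⟨m, a, ha, rfl⟩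
    refine isOpen_iff_mem_nhds.2 fun x hx => ?_
    obtain ⟨N, hxN, hN⟩ := h x
    obtain ⟨n, c, hc, hN⟩ := hN m
    obtain ⟨a', ha', e⟩ := hN a ha
    have hopen : IsOpen (Subtype.val ⁻¹' ((N : Set (ofForms Γ)) ∩ {y | a' y ≠ 0}) :
        Set ((ofForms Γ).restrict Z)) :=
      (N.isOpen.inter (isOpen_ne_zero Γ ha')).preimage continuous_subtype_val
    refine Filter.mem_of_superset (hopen.mem_nhds ⟨hxN, ?_⟩) fun y hy => ?_
    · have hx : a (f x) ≠ 0 := hx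
      rw [e x hxN] at hx
      exact right_ne_zero_of_mul hx
    · change a (f y) ≠ 0
      rw [e y hy.1]
      exact mul_ne_zero (hc y) hy.2
  refine ⟨hcont, fun U g hg x => ?_⟩
  obtain ⟨(N : Opens (ofForms Δ)), m, a, b, ha, hb, hxN, e⟩ := hg ⟨f x.1, x.2⟩
  obtain ⟨N', hxN', hN'⟩ := h x.1
  obtain ⟨n, c, hc, hN'⟩ := hN' m
  obtain ⟨a', ha', ea⟩ := hN' a ha
  obtain ⟨b', hb', eb⟩ := hN' b hb
  obtain ⟨O, hO, hON⟩ := isOpen_induced_iff.1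
    (IsOpen.preimage hcont (IsOpen.inter U.isOpen N.isOpen))
  have hmemO : ∀ y : (ofForms Γ).restrict Z, y.1 ∈ O ↔ f y ∈ U ∧ f y ∈ N := fun y =>
    (Set.ext_iff.1 hON y)
  -- Nonvanishing of b' is imposed on an ambient open set, because a regular function on Z must
  -- locally extend to the ambient space.
  let N'' : Opens (ofForms Γ) := (⟨O, hO⟩ ⊓ N') ⊓ ⟨_, isOpen_ne_zero Γ hb'⟩
  have hb0 : ∀ y : (ofForms Γ).restrict Z, y.1 ∈ O → y.1 ∈ N' → b' y.1 ≠ 0 := fun y hy hy' => by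
    have := (e ⟨f y, ((hmemO y).1 hy).1⟩ ((hmemO y).1 hy).2).1
    rw [eb y hy'] at this
    exact right_ne_zero_of_mul this
  have hxO : x.1.1 ∈ O := (hmemO x.1).2 ⟨x.2, hxN⟩
  refine ⟨N'', fun y => a' y.1 / b' y.1, div_mem_reg Γ ha' hb' fun y hy => hy.2,
    ⟨⟨hxO, hxN'⟩, hb0 x.1 hxO hxN'⟩, fun y hy => ?_⟩
  have h1 := (e ⟨f y.1, ((hmemO y.1).1 hy.1.1).1⟩ ((hmemO y.1).1 hy.1.1).2).2
  refine h1.trans ?_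
  change a (f y.1) / b (f y.1) = a' y.1.1 / b' y.1.1
  rw [ea y.1 hy.1.2, eb y.1 hy.1.2, mul_div_mul_left _ _ (hc y.1)]

end Forms

/-- A map to a subspace is a morphism if it is a morphism to the ambient space. -/
theorem isMorphism_restrict {X : SpaceWithFunctions.{u}} {Y : SpaceWithFunctions.{v}} {Z : Set Y}
    (f : X → Y.restrict Z) (h : IsMorphism (X := X) (Y := Y) fun x => (f x).1) :
    IsMorphism f := by
  have hcont : Continuous f := continuous_induced_rng.2 h.continuous
  refine ⟨hcont, fun U g hg => X.glue _ fun x => ?_⟩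
  obtain ⟨N, g', hg', hx, e⟩ := hg ⟨f x, x.2⟩
  refine ⟨U.comap ⟨f, hcont⟩ ⊓ N.comap ⟨_, h.continuous⟩, inf_le_left, ⟨x.2, hx⟩, ?_⟩
  have h1 := X.res (inf_le_right : U.comap ⟨f, hcont⟩ ⊓ N.comap ⟨_, h.continuous⟩ ≤ _) _
    (h.pullback N g' hg')
  convert h1 using 2 with y
  exact e ⟨f y, y.2.1⟩ y.2.2

end SpaceWithFunctions

section Substitution

variable {σ : Type*} {τ : Type*} {M M' : Type} [AddCommMonoid M] [AddCommMonoid M']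

/-- The homomorphism θ translates degrees on the target into degrees on the source, which allows
passing between gradings by ℕ and by ℕ × ℕ. -/
theorem isWeightedHomogeneous_aeval {w : σ → M} {w' : τ → M'} {θ : M' →+ M}
    {Q : τ → MvPolynomial σ ℂ} (hQ : ∀ i, IsWeightedHomogeneous w (Q i) (θ (w' i))) {m : M'}
    {P : MvPolynomial τ ℂ} (hP : IsWeightedHomogeneous w' P m) :
    IsWeightedHomogeneous w (aeval Q P) (θ m) := by
  rw [aeval_def, eval₂_eq]
  refine IsWeightedHomogeneous.sum _ _ _ fun d hd => ?_
  have hd' : Finsupp.weight w' d = m := hP (mem_support_iff.1 hd)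
  have h1 : IsWeightedHomogeneous w (∏ i ∈ d.support, Q i ^ d i) (θ m) := by
    rw [← hd', Finsupp.weight_apply, Finsupp.sum, map_sum]
    refine IsWeightedHomogeneous.prod _ _ _ fun i _ => ?_
    rw [map_nsmul]
    exact (hQ i).pow (d i)
  simpa using (isWeightedHomogeneous_C w (P.coeff d)).mul h1

theorem eval_aeval (Q : τ → MvPolynomial σ ℂ) (P : MvPolynomial τ ℂ) (x : σ → ℂ) :
    eval x (aeval Q P) = eval (fun i => eval x (Q i)) P := by
  induction P using MvPolynomial.induction_on with
  | C c => simp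
  | add P Q' hP hQ => rw [map_add, map_add, hP, hQ, map_add]
  | mul_X P l hP => rw [map_mul, map_mul, hP, map_mul, aeval_X, eval_X]

variable {X : Type u} {Y : Type v} {w : σ → M} {s : σ → X → ℂ} {w' : τ → M'} {s' : τ → Y → ℂ}

/-- A map which locally is given by homogeneous polynomials in the coordinates, up to rescaling of
the target coordinates, is a morphism. -/
theorem isMorphism_of_substitution {Z : Set (ofForms (evalForms w s))}
    (f : (ofForms (evalForms w s)).restrict Z → ofForms (evalForms w' s'))
    (h : ∀ x : (ofForms (evalForms w s)).restrict Z, ∃ N : Opens (ofForms (evalForms w s)),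
      x.1 ∈ N ∧ ∃ (θ : M' →+ M) (Q : τ → MvPolynomial σ ℂ),
        (∀ i, IsWeightedHomogeneous w (Q i) (θ (w' i))) ∧
        ∀ y : (ofForms (evalForms w s)).restrict Z, y.1 ∈ N →
          ∃ c : Multiplicative M' →* ℂ, (∀ m, c m ≠ 0) ∧
            ∀ i, s' i (f y) = c (.ofAdd (w' i)) * eval (fun j => s j y.1) (Q i)) :
    IsMorphism f := by
  classical
  refine isMorphism_of_forms _ _ f fun x => ?_
  obtain ⟨N, hxN, θ, Q, hQ, hN⟩ := h x
  choose! c hc0 hc using hN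
  refine ⟨N, hxN, fun m => ⟨θ m, fun y => if y.1 ∈ N then c y (.ofAdd m) else 1, fun y => ?_, ?_⟩⟩
  · dsimp only
    split_ifs with hy
    · exact hc0 y hy _
    · exact one_ne_zero
  · rintro _ ⟨P, hP, rfl⟩
    refine ⟨_, ⟨aeval Q P, isWeightedHomogeneous_aeval hQ hP, rfl⟩, fun y hy => ?_⟩
    change aeval s' P (f y) = (if y.1 ∈ N then c y (.ofAdd m) else 1) * aeval s (aeval Q P) y.1
    rw [if_pos hy]
    refine (aeval_apply_eq_eval s' P (f y)).trans (Eq.trans ?_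
      (congrArg (c y (.ofAdd m) * ·) (aeval_apply_eq_eval s (aeval Q P) y.1).symm))
    rw [eval_aeval, ← eval_scale hP]
    congr 2
    funext i
    exact hc y hy i

end Substitution

end ClassicalAG

namespace PfaffianCubic

open Matrix Module

/-! ### Adjugates and corank one. -/

section MatrixLemmas

variable {ι : Type*} [Fintype ι] [DecidableEq ι] {N : Matrix ι ι ℂ}

/-- The adjugate entry is the determinant of N with row i replaced by the j-th coordinate
functional, and z is in the kernel of that matrix. -/
theorem eq_zero_of_adjugate_ne_zero {i j : ι} (h : N.adjugate j i ≠ 0) {z : ι → ℂ}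
    (hz : N *ᵥ z = 0) (hj : z j = 0) : z = 0 := by
  rw [adjugate_apply] at h
  by_contra hz0
  refine h (exists_mulVec_eq_zero_iff.1 ⟨z, hz0, ?_⟩)
  ext k
  by_cases hk : k = i
  · subst hk
    simp [mulVec, updateRow_self, hj]
  · have := congrFun hz k
    simpa [mulVec, updateRow_ne hk] using this

/-- With x i ≠ 0, row i is redundant, so it may be replaced by a coordinate functional that is
nonzero on the kernel line. The resulting matrix is invertible, and its determinant is an adjugate
entry. -/
theorem adjugate_ne_zero_of_ker {x : ι → ℂ} (hx0 : x ≠ 0) (hx : x ᵥ* N = 0)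
    (h : ∀ z z' : ι → ℂ, N *ᵥ z = 0 → N *ᵥ z' = 0 → z ≠ 0 → ∃ c : ℂ, z' = c • z) :
    ∃ i j, N.adjugate j i ≠ 0 := by
  obtain ⟨z, hz0, hz⟩ := exists_mulVec_eq_zero_iff.2 (exists_vecMul_eq_zero_iff.1 ⟨x, hx0, hx⟩)
  obtain ⟨i, hi⟩ := Function.ne_iff.1 hx0
  obtain ⟨j, hj⟩ := Function.ne_iff.1 hz0
  refine ⟨i, j, fun h0 => ?_⟩
  rw [adjugate_apply] at h0
  obtain ⟨y, hy0, hy⟩ := exists_mulVec_eq_zero_iff.2 h0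
  have hyj : y j = 0 := by
    have := congrFun hy i
    simpa [mulVec, updateRow_self] using this
  have hyk : ∀ k, k ≠ i → (N *ᵥ y) k = 0 := fun k hk => by
    have := congrFun hy k
    simpa [mulVec, updateRow_ne hk] using this
  have hyi : (N *ᵥ y) i = 0 := by
    have h1 : x ⬝ᵥ N *ᵥ y = 0 := by rw [dotProduct_mulVec, hx, zero_dotProduct]
    rw [dotProduct, Finset.sum_eq_single i (fun k _ hk => by rw [hyk k hk, mul_zero])
      (fun hi => (hi (Finset.mem_univ i)).elim)] at h1
    exact (mul_eq_zero.1 h1).resolve_left hi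
  have hNy : N *ᵥ y = 0 := by
    ext k
    by_cases hk : k = i
    · subst hk
      exact hyi
    · exact hyk k hk
  obtain ⟨c, rfl⟩ := h z y hz hNy hz0
  have hc : c = 0 := by
    simp only [Pi.smul_apply, smul_eq_mul, mul_eq_zero] at hyj
    exact hyj.resolve_right hj
  simp [hc] at hy0

end MatrixLemmas

/-! ### Irreducibility of the parameter space of degenerate forms and covectors. -/

section Parametrization

open MvPolynomial

theorem map_complMatrix {R S : Type*} [CommRing R] [CommRing S] (f : R →+* S)
    (q : Fin 6 → Fin 6 → Fin 6 → Fin 6 → R) :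
    (complMatrix q).map f = complMatrix fun a b c d => f (q a b c d) := by
  ext i j
  fin_cases i <;> fin_cases j <;> simp [complMatrix]

theorem map_pfAdj {R S : Type*} [CommRing R] [CommRing S] (f : R →+* S)
    (A : Matrix (Fin 6) (Fin 6) R) : (pfAdj A).map f = pfAdj (A.map f) := by
  rw [pfAdj, pfBilin, map_complMatrix]
  simp only [pfFour, map_add, map_sub, map_mul]
  rfl

variable {v : Fin 6 → Matrix (Fin 6) (Fin 6) ℂ}

theorem eval_rename_genericComb (x φ : Fin 6 → ℂ) (i j : Fin 6) :
    eval (Sum.elim x φ) (pfAdj ((genericComb v).map (rename Sum.inl :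
      MvPolynomial (Fin 6) ℂ →ₐ[ℂ] MvPolynomial (Fin 6 ⊕ Fin 6) ℂ)) i j) =
      pfAdj (linComb v x) i j := by
  have h := congrFun (congrFun (map_pfAdj (eval (Sum.elim x φ)) ((genericComb v).map (rename Sum.inl :
      MvPolynomial (Fin 6) ℂ →ₐ[ℂ] MvPolynomial (Fin 6 ⊕ Fin 6) ℂ))) i) j
  rw [Matrix.map_apply] at h
  rw [h]
  congr 1
  ext a b
  rw [Matrix.map_apply, Matrix.map_apply, eval_rename, ← eval_genericComb]
  rfl

/-- Irreducibility of the incidence variety of the pfaffian cubic, in terms of its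
parametrization by a degenerate form and a covector. -/
theorem exists_pf_eq_zero_of_sum (hli : LinearIndependent ℂ v) (hv : ∀ i, (v i)ᵀ = -v i)
    (hK : ∀ x, linComb v x ≠ 0 → finrank ℂ (LinearMap.ker (linComb v x).mulVecLin) ≤ 2)
    {p q : MvPolynomial (Fin 6 ⊕ Fin 6) ℂ} {x φ y ψ : Fin 6 → ℂ} (hx : pf (linComb v x) = 0)
    (hpx : eval (Sum.elim x φ) p ≠ 0) (hy : pf (linComb v y) = 0)
    (hqy : eval (Sum.elim y ψ) q ≠ 0) :
    ∃ z χ, pf (linComb v z) = 0 ∧ eval (Sum.elim z χ) p ≠ 0 ∧ eval (Sum.elim z χ) q ≠ 0 := by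
  have h1 : ∀ (r : MvPolynomial (Fin 6 ⊕ Fin 6) ℂ) (x φ : Fin 6 → ℂ),
      eval φ (aeval (Sum.elim (fun i => C (x i)) MvPolynomial.X) r) = eval (Sum.elim x φ) r := fun r x φ => by
    rw [ClassicalAG.eval_aeval]
    congr 2
    funext i
    rcases i with i | i <;> simp
  have h2 : ∀ (r : MvPolynomial (Fin 6 ⊕ Fin 6) ℂ) (x φ : Fin 6 → ℂ),
      eval x (aeval (Sum.elim MvPolynomial.X (fun i => C (φ i))) r) = eval (Sum.elim x φ) r := fun r x φ => by
    rw [ClassicalAG.eval_aeval]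
    congr 2
    funext i
    rcases i with i | i <;> simp
  -- A covector χ good for p over x and for q over y exists since the covectors form an affine
  -- space. With χ fixed, irreducibility of the cubic finds z.
  obtain ⟨χ, hχ⟩ : ∃ χ, eval χ ((aeval (Sum.elim (fun i => C (x i)) MvPolynomial.X) p :
      MvPolynomial (Fin 6) ℂ) * aeval (Sum.elim (fun i => C (y i)) MvPolynomial.X) q) ≠ 0 := by
    by_contra! h
    have h0 := MvPolynomial.funext (q := 0) fun χ => (h χ).trans (map_zero _).symm
    rcases mul_eq_zero.1 h0 with h0 | h0
    · rw [← h1, h0, map_zero] at hpx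
      exact hpx rfl
    · rw [← h1, h0, map_zero] at hqy
      exact hqy rfl
  rw [map_mul, h1, h1] at hχ
  obtain ⟨z, hz, hpz, hqz⟩ := exists_pf_eq_zero hli hv hK hx
    (p := aeval (Sum.elim MvPolynomial.X (fun i => C (χ i))) p)
    (by rw [h2]; exact left_ne_zero_of_mul hχ) hy
    (q := aeval (Sum.elim MvPolynomial.X (fun i => C (χ i))) q)
    (by rw [h2]; exact right_ne_zero_of_mul hχ)
  rw [h2] at hpz hqz
  exact ⟨z, χ, hz, hpz, hqz⟩

end Parametrization

/-! ### Gram matrices: passing from alternating forms to skew matrices. -/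

section Gram

variable {W : Type*} [AddCommGroup W] [Module ℂ W] (b : Basis (Fin 6) ℂ W)

/-- The Gram matrix of a skew form. -/
noncomputable def gram : (W [⋀^Fin 2]→ₗ[ℂ] ℂ) →ₗ[ℂ] Matrix (Fin 6) (Fin 6) ℂ where
  toFun ω := Matrix.of fun i j => ω ![b i, b j]
  map_add' ω ω' := by ext; simp
  map_smul' c ω := by ext; simp

theorem alternating_swap (ω : W [⋀^Fin 2]→ₗ[ℂ] ℂ) (u w : W) : ω ![u, w] = -ω ![w, u] := by
  have := ω.map_swap ![w, u] (show (0 : Fin 2) ≠ 1 by decide)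
  rw [← this]
  congr 1
  ext i
  fin_cases i <;> rfl

theorem gram_transpose (ω : W [⋀^Fin 2]→ₗ[ℂ] ℂ) : (gram b ω)ᵀ = -gram b ω := by
  ext i j
  exact alternating_swap ω _ _

/-- A skew form as a bilinear map. -/
noncomputable def pairing (ω : W [⋀^Fin 2]→ₗ[ℂ] ℂ) : W →ₗ[ℂ] W →ₗ[ℂ] ℂ :=
  LinearMap.mk₂ ℂ (fun u w => ω ![u, w]) (fun u u' w => ω.map_vecCons_add ![w] u u')
    (fun c u w => ω.map_vecCons_smul ![w] c u)
    (fun u w w' => by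
      rw [alternating_swap, alternating_swap ω u w, alternating_swap ω u w']
      exact (congrArg Neg.neg (ω.map_vecCons_add ![u] w w')).trans (neg_add _ _))
    (fun c u w => by
      rw [alternating_swap, alternating_swap ω u w, smul_neg]
      exact congrArg Neg.neg (ω.map_vecCons_smul ![u] c w))

theorem pairing_apply (ω : W [⋀^Fin 2]→ₗ[ℂ] ℂ) (u w : W) : pairing ω u w = ω ![u, w] := rfl

theorem alternating_eq_dotProduct (ω : W [⋀^Fin 2]→ₗ[ℂ] ℂ) (u w : W) :
    ω ![u, w] = b.equivFun u ⬝ᵥ gram b ω *ᵥ b.equivFun w := by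
  rw [← pairing_apply]
  conv_lhs => rw [← b.sum_equivFun u, ← b.sum_equivFun w]
  simp only [map_sum, map_smul, LinearMap.sum_apply, LinearMap.smul_apply, pairing_apply,
    smul_eq_mul, dotProduct, mulVec, Finset.mul_sum, gram, LinearMap.coe_mk, AddHom.coe_mk, of_apply]
  rw [Finset.sum_comm]
  refine Finset.sum_congr rfl fun i _ => Finset.sum_congr rfl fun j _ => by ring

theorem mem_formKernel_iff {ω : W [⋀^Fin 2]→ₗ[ℂ] ℂ} {w : W} :
    w ∈ formKernel ω ↔ gram b ω *ᵥ b.equivFun w = 0 := by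
  rw [mem_formKernel]
  refine ⟨fun h => dotProduct_eq_zero _ fun x => ?_, fun h u => ?_⟩
  · rw [dotProduct_comm]
    have h1 := alternating_eq_dotProduct b ω (b.equivFun.symm x) w
    rw [LinearEquiv.apply_symm_apply] at h1
    rw [← h1, alternating_swap, h, neg_zero]
  · rw [alternating_swap, alternating_eq_dotProduct b, h, dotProduct_zero, neg_zero]

theorem gram_injective : Function.Injective (gram b) := by
  rw [← LinearMap.ker_eq_bot, Submodule.eq_bot_iff]
  intro ω hω
  ext x
  have : x = ![x 0, x 1] := by
    ext i
    fin_cases i <;> rfl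
  rw [this, alternating_eq_dotProduct b, LinearMap.mem_ker.1 hω]
  simp

theorem finrank_range_gram (ω : W [⋀^Fin 2]→ₗ[ℂ] ℂ) :
    finrank ℂ (LinearMap.range (gram b ω).mulVecLin) = formRank ω := by
  have : Module.Finite ℂ W := Module.Finite.of_basis b
  have h1 := (gram b ω).mulVecLin.finrank_range_add_finrank_ker
  have h2 := ω.curryLeft.finrank_range_add_finrank_ker
  have h3 : finrank ℂ (LinearMap.ker ω.curryLeft) =
      finrank ℂ (LinearMap.ker (gram b ω).mulVecLin) := by
    have : LinearMap.ker ω.curryLeft =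
        (LinearMap.ker (gram b ω).mulVecLin).comap b.equivFun.toLinearMap := by
      ext w
      exact mem_formKernel_iff b
    rw [this]
    exact (b.equivFun.ofSubmodule' _).finrank_eq
  rw [finrank_eq_card_basis b] at h2
  simp only [finrank_fintype_fun_eq_card, Fintype.card_fin] at h1 h2
  rw [formRank]
  omega

/-- The rank is even, nonzero and different from 2, hence at least 4. -/
theorem finrank_ker_gram_le {ω : W [⋀^Fin 2]→ₗ[ℂ] ℂ} (h0 : ω ≠ 0) (h2 : formRank ω ≠ 2) :
    finrank ℂ (LinearMap.ker (gram b ω).mulVecLin) ≤ 2 := by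
  have h1 := (gram b ω).mulVecLin.finrank_range_add_finrank_ker
  obtain ⟨m, hm⟩ := even_finrank_range (gram_transpose b ω)
  rw [finrank_fintype_fun_eq_card, Fintype.card_fin] at h1
  rw [← finrank_range_gram b] at h2
  have hm0 : m ≠ 0 := by
    rintro rfl
    have h3 := LinearMap.range_eq_bot.1 (Submodule.finrank_eq_zero.1 hm)
    rw [← Matrix.toLin'_apply', LinearEquiv.map_eq_zero_iff] at h3
    exact h0 (gram_injective b (h3.trans (map_zero _).symm))
  omega

end Gram
end PfaffianCubic

namespace PfaffianCubic

open Matrix Module ClassicalAG ClassicalAG.SpaceWithFunctions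
open scoped LinearAlgebra.Projectivization

universe u

variable {W : Type u} [AddCommGroup W] [Module ℂ W] (b : Basis (Fin 6) ℂ W)
  {V : Submodule ℂ (W [⋀^Fin 2]→ₗ[ℂ] ℂ)} (v : Basis (Fin 6) ℂ V)

/-! ### The evaluation matrix: its left kernel is the fibre of p, its right kernel detects the image
of q. -/

section EvaluationMatrix

/-- The matrix of the evaluation map `V → W^∨`, `ω ↦ ω(w, -)`. -/
noncomputable def evMatrix (w : W) : Matrix (Fin 6) (Fin 6) ℂ :=
  Matrix.of fun k j => (v k : W [⋀^Fin 2]→ₗ[ℂ] ℂ) ![w, b j]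

/-- The evaluation matrix at a generic vector. -/
noncomputable def evMatrixPoly : Matrix (Fin 6) (Fin 6) (MvPolynomial (Dual ℂ W) ℂ) :=
  Matrix.of fun k j => MvPolynomial.X ((pairing (v k : W [⋀^Fin 2]→ₗ[ℂ] ℂ)).flip (b j))

theorem eval_adjugate_evMatrixPoly (w : W) (j i : Fin 6) :
    MvPolynomial.eval (fun l : Dual ℂ W => l w) ((evMatrixPoly b v).adjugate j i) =
      (evMatrix b v w).adjugate j i := by
  have h := RingHom.map_adjugate (MvPolynomial.eval (fun l : Dual ℂ W => l w)) (evMatrixPoly b v)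
  have h1 : (MvPolynomial.eval (fun l : Dual ℂ W => l w)).mapMatrix (evMatrixPoly b v) =
      evMatrix b v w := by
    ext k j
    simp [evMatrixPoly, evMatrix, pairing_apply]
  rw [h1] at h
  exact congrFun (congrFun h j) i

theorem adjugate_evMatrixPoly_isHomogeneous (j i : Fin 6) :
    ((evMatrixPoly b v).adjugate j i).IsHomogeneous 5 := by
  have hdet : ∀ M : Matrix (Fin 5) (Fin 5) (MvPolynomial (Dual ℂ W) ℂ),
      (∀ k l, (M k l).IsHomogeneous 1) → M.det.IsHomogeneous 5 := fun M hM => by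
    rw [det_apply]
    refine MvPolynomial.IsHomogeneous.sum _ _ _ fun s _ => ?_
    have h1 : (∏ k, M (s k) k).IsHomogeneous 5 := by
      simpa using MvPolynomial.IsHomogeneous.prod Finset.univ (fun k => M (s k) k) (fun _ => 1)
        fun k _ => hM _ _
    rcases Int.units_eq_one_or (Equiv.Perm.sign s) with h | h
    · simpa [h] using h1
    · simpa [h] using h1.neg
  rw [adjugate_fin_succ_eq_det_submatrix]
  have h1 := hdet ((evMatrixPoly b v).submatrix i.succAbove j.succAbove)
    fun k l => MvPolynomial.isHomogeneous_X ℂ _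
  rcases neg_one_pow_eq_or (MvPolynomial (Dual ℂ W) ℂ) ((i : ℕ) + j) with h | h
  · simpa [h] using h1
  · simpa [h] using h1.neg

theorem apply_eq_sum (ω : V) (w u : W) : (ω : W [⋀^Fin 2]→ₗ[ℂ] ℂ) ![w, u] =
    ∑ k, v.equivFun ω k * (v k : W [⋀^Fin 2]→ₗ[ℂ] ℂ) ![w, u] := by
  let L : V →ₗ[ℂ] ℂ :=
    { toFun := fun ω => (ω : W [⋀^Fin 2]→ₗ[ℂ] ℂ) ![w, u]
      map_add' := fun _ _ => rfl
      map_smul' := fun _ _ => rfl }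
  have h := congrArg L (v.sum_equivFun ω)
  rw [map_sum] at h
  exact h.symm

theorem mem_formKernel_iff_vecMul {ω : V} {w : W} :
    w ∈ formKernel (ω : W [⋀^Fin 2]→ₗ[ℂ] ℂ) ↔ v.equivFun ω ᵥ* evMatrix b v w = 0 := by
  have h : ∀ j, (v.equivFun ω ᵥ* evMatrix b v w) j = (ω : W [⋀^Fin 2]→ₗ[ℂ] ℂ) ![w, b j] :=
    fun j => (apply_eq_sum v ω w (b j)).symm
  rw [mem_formKernel]
  constructor
  · intro h1
    ext j
    rw [h, h1]
    rfl
  · intro h1 u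
    have h2 : pairing (ω : W [⋀^Fin 2]→ₗ[ℂ] ℂ) w = 0 := b.ext fun j => by
      rw [pairing_apply, ← h, h1]
      rfl
    rw [← pairing_apply, h2]
    rfl

theorem evMatrix_mulVec (w u : W) :
    evMatrix b v w *ᵥ b.equivFun u = fun k => (v k : W [⋀^Fin 2]→ₗ[ℂ] ℂ) ![w, u] := by
  ext k
  rw [← pairing_apply]
  conv_rhs => rw [← b.sum_equivFun u, map_sum]
  simp only [map_smul, smul_eq_mul, pairing_apply]
  rw [mulVec, dotProduct]
  exact Finset.sum_congr rfl fun j _ => mul_comm (evMatrix b v w k j) (b.equivFun u j)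

theorem evMatrix_mulVec_eq_zero_iff {w u : W} :
    evMatrix b v w *ᵥ b.equivFun u = 0 ↔ ∀ ω ∈ V, ω ![w, u] = 0 := by
  rw [evMatrix_mulVec]
  constructor
  · intro h ω hω
    rw [apply_eq_sum v ⟨ω, hω⟩ w u]
    exact Finset.sum_eq_zero fun k _ => by
      rw [congrFun h k]
      exact mul_zero _
  · intro h
    ext k
    exact h _ (v k).2

theorem alternating_self (ω : W [⋀^Fin 2]→ₗ[ℂ] ℂ) (w : W) : ω ![w, w] = 0 :=
  ω.map_eq_zero_of_eq _ (show ![w, w] 0 = ![w, w] 1 from rfl) (by decide)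

theorem evMatrix_mulVec_self (w : W) : evMatrix b v w *ᵥ b.equivFun w = 0 :=
  (evMatrix_mulVec_eq_zero_iff b v).2 fun ω _ => alternating_self ω w

theorem det_evMatrix {w : W} (hw : w ≠ 0) : (evMatrix b v w).det = 0 :=
  exists_mulVec_eq_zero_iff.1 ⟨b.equivFun w, b.equivFun.map_ne_zero_iff.2 hw, evMatrix_mulVec_self b v w⟩

/-- Where the adjugate is nonzero, the left kernel is a line on which the i-th coordinate is
injective; the scalar is the ratio of these coordinates. -/
theorem eq_smul_of_adjugate_ne_zero {w : W} {i j : Fin 6} (h : (evMatrix b v w).adjugate j i ≠ 0)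
    {ω ω' : V} (hω0 : ω ≠ 0) (hω : w ∈ formKernel (ω : W [⋀^Fin 2]→ₗ[ℂ] ℂ))
    (hω' : w ∈ formKernel (ω' : W [⋀^Fin 2]→ₗ[ℂ] ℂ)) : ∃ c : ℂ, ω' = c • ω := by
  have hT : (evMatrix b v w)ᵀ.adjugate i j ≠ 0 := by
    rwa [← adjugate_transpose]
  rw [mem_formKernel_iff_vecMul b v, ← mulVec_transpose] at hω hω'
  have h0 : v.equivFun ω i ≠ 0 := fun h0 =>
    hω0 (v.equivFun.map_eq_zero_iff.1 (eq_zero_of_adjugate_ne_zero hT hω h0))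
  refine ⟨v.equivFun ω' i / v.equivFun ω i, ?_⟩
  have h1 := eq_zero_of_adjugate_ne_zero hT
    (z := v.equivFun (ω' - (v.equivFun ω' i / v.equivFun ω i) • ω)) ?_ ?_
  · exact sub_eq_zero.1 (v.equivFun.map_eq_zero_iff.1 h1)
  · rw [map_sub, map_smul, mulVec_sub, mulVec_smul, hω, hω', smul_zero, sub_zero]
  · rw [map_sub, map_smul, Pi.sub_apply, Pi.smul_apply, smul_eq_mul, div_mul_cancel₀ _ h0, sub_self]

/-- A form in `V` killing `w` given by a row of the adjugate of the evaluation matrix. -/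
noncomputable def adjForm (j : Fin 6) (w : W) : V :=
  ∑ i, (evMatrix b v w).adjugate j i • v i

theorem mem_formKernel_adjForm (j : Fin 6) {w : W} (hw : w ≠ 0) :
    w ∈ formKernel (adjForm b v j w : W [⋀^Fin 2]→ₗ[ℂ] ℂ) := by
  rw [mem_formKernel_iff_vecMul b v]
  have h1 : v.equivFun (adjForm b v j w) = (evMatrix b v w).adjugate j := by
    rw [adjForm, ← v.equivFun_symm_apply, LinearEquiv.apply_symm_apply]
  have h2 := congrFun (adjugate_mul (evMatrix b v w)) j
  rw [det_evMatrix b v hw, zero_smul] at h2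
  rw [h1]
  exact h2

theorem adjForm_ne_zero {i j : Fin 6} {w : W} (h : (evMatrix b v w).adjugate j i ≠ 0) :
    adjForm b v j w ≠ 0 := by
  intro h0
  have h1 : v.equivFun (adjForm b v j w) = (evMatrix b v w).adjugate j := by
    rw [adjForm, ← v.equivFun_symm_apply, LinearEquiv.apply_symm_apply]
  rw [h0, map_zero] at h1
  exact h (by rw [← h1]; rfl)

theorem exists_form_of_ne_zero (b : Basis (Fin 6) ℂ W) (v : Basis (Fin 6) ℂ V) {w : W} (hw : w ≠ 0) :
    ∃ ω : V, ω ≠ 0 ∧ w ∈ formKernel (ω : W [⋀^Fin 2]→ₗ[ℂ] ℂ) := by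
  obtain ⟨x, hx0, hx⟩ := exists_vecMul_eq_zero_iff.2 (det_evMatrix b v hw)
  refine ⟨v.equivFun.symm x, v.equivFun.symm.map_ne_zero_iff.2 hx0, ?_⟩
  rw [mem_formKernel_iff_vecMul b v, LinearEquiv.apply_symm_apply]
  exact hx

/-- The evaluation matrix at `w` has rank at most four if and only if `w` lies in a plane on which
all forms in `V` vanish. -/
theorem adjugate_eq_zero_iff {w : W} (hw : w ≠ 0) :
    (evMatrix b v w).adjugate = 0 ↔ ∃ u, u ∉ ℂ ∙ w ∧ ∀ ω ∈ V, ω ![w, u] = 0 := by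
  constructor
  · intro h
    obtain ⟨x, hx0, hx⟩ := exists_vecMul_eq_zero_iff.2 (det_evMatrix b v hw)
    by_contra! hcon
    -- Without such a u the right kernel is the line ℂw, so the corank is one and the adjugate
    -- cannot vanish.
    obtain ⟨i, j, hij⟩ := adjugate_ne_zero_of_ker hx0 hx fun z z' hz hz' hz0 => by
      have hmem : ∀ y, evMatrix b v w *ᵥ y = 0 → ∃ c : ℂ, y = c • b.equivFun w := fun y hy => by
        obtain ⟨u, rfl⟩ := b.equivFun.surjective y
        rw [evMatrix_mulVec_eq_zero_iff] at hy
        by_contra hu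
        obtain ⟨ω, hω, hne⟩ := hcon u fun hmem => hu (by
          obtain ⟨c, rfl⟩ := Submodule.mem_span_singleton.1 hmem
          exact ⟨c, map_smul _ _ _⟩)
        exact hne (hy ω hω)
      obtain ⟨c, rfl⟩ := hmem z hz
      obtain ⟨c', rfl⟩ := hmem z' hz'
      have hc : c ≠ 0 := by
        rintro rfl
        simp at hz0
      exact ⟨c' / c, by rw [smul_smul, div_mul_cancel₀ _ hc]⟩
    rw [h] at hij
    exact hij rfl
  · rintro ⟨u, hu, h⟩
    ext j i
    by_contra hij
    change (evMatrix b v w).adjugate j i ≠ 0 at hij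
    have hw' := evMatrix_mulVec_self b v w
    have hu' := (evMatrix_mulVec_eq_zero_iff b v).2 h
    have hj : b.equivFun w j ≠ 0 := fun h0 =>
      hw (b.equivFun.map_eq_zero_iff.1 (eq_zero_of_adjugate_ne_zero hij hw' h0))
    -- The multiple of w subtracted from u is the one cancelling coordinate j.
    have h1 := eq_zero_of_adjugate_ne_zero hij
      (z := b.equivFun (u - (b.equivFun u j / b.equivFun w j) • w)) ?_ ?_
    · refine hu (Submodule.mem_span_singleton.2 ⟨b.equivFun u j / b.equivFun w j, ?_⟩)
      exact (sub_eq_zero.1 (b.equivFun.map_eq_zero_iff.1 h1)).symm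
    · rw [map_sub, map_smul, mulVec_sub, mulVec_smul, hw', hu', smul_zero, sub_zero]
    · rw [map_sub, map_smul, Pi.sub_apply, Pi.smul_apply, smul_eq_mul, div_mul_cancel₀ _ hj, sub_self]

/-- The corank-one criterion applied to the transpose: w supplies the relation, and uniqueness of
the form killing w bounds the kernel. -/
theorem adjugate_ne_zero_of_unique {w : W} (hw : w ≠ 0)
    (h : ∀ ω ω' : V, w ∈ formKernel (ω : W [⋀^Fin 2]→ₗ[ℂ] ℂ) →
      w ∈ formKernel (ω' : W [⋀^Fin 2]→ₗ[ℂ] ℂ) → ω ≠ 0 → ∃ c : ℂ, ω' = c • ω) :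
    ∃ i j, (evMatrix b v w).adjugate j i ≠ 0 := by
  obtain ⟨i, j, hij⟩ := adjugate_ne_zero_of_ker (N := (evMatrix b v w)ᵀ)
    (x := b.equivFun w) (b.equivFun.map_ne_zero_iff.2 hw)
    (by rw [vecMul_transpose]; exact evMatrix_mulVec_self b v w)
    fun z z' hz hz' hz0 => by
      rw [mulVec_transpose, ← v.equivFun.apply_symm_apply z, ← mem_formKernel_iff_vecMul] at hz
      rw [mulVec_transpose, ← v.equivFun.apply_symm_apply z', ← mem_formKernel_iff_vecMul] at hz'
      obtain ⟨c, hc⟩ := h _ _ hz hz' (v.equivFun.symm.map_ne_zero_iff.2 hz0)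
      refine ⟨c, ?_⟩
      rw [← map_smul] at hc
      exact v.equivFun.symm.injective hc
  refine ⟨j, i, ?_⟩
  rwa [← adjugate_transpose] at hij

end EvaluationMatrix
end PfaffianCubic

/-! ### Bihomogeneous polynomials and change of representatives. -/

namespace ClassicalAG

open MvPolynomial SpaceWithFunctions
open scoped LinearAlgebra.Projectivization

universe u

/-- The multiplicative function `(a, b) ↦ s ^ a * t ^ b`. -/
noncomputable def bidegreeHom (s t : ℂ) : Multiplicative (ℕ × ℕ) →* ℂ where
  toFun m := s ^ m.toAdd.1 * t ^ m.toAdd.2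
  map_one' := by simp
  map_mul' m n := by simp only [toAdd_mul, Prod.fst_add, Prod.snd_add, pow_add]; ring

theorem bidegreeHom_ne_zero {s t : ℂ} (hs : s ≠ 0) (ht : t ≠ 0) (m : Multiplicative (ℕ × ℕ)) :
    bidegreeHom s t m ≠ 0 :=
  mul_ne_zero (pow_ne_zero _ hs) (pow_ne_zero _ ht)

variable {E F : Type u} [AddCommGroup E] [Module ℂ E] [AddCommGroup F] [Module ℂ F]

/-- The values of linear functionals on two vectors. -/
def biEval (e : E) (f : F) : Module.Dual ℂ E ⊕ Module.Dual ℂ F → ℂ :=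
  Sum.elim (fun l => l e) (fun l => l f)

theorem aeval_biproj (P : MvPolynomial (Module.Dual ℂ E ⊕ Module.Dual ℂ F) ℂ)
    (z : ℙ ℂ E × ℙ ℂ F) :
    aeval (Sum.elim (fun (l : Module.Dual ℂ E) (z : ℙ ℂ E × ℙ ℂ F) => l z.1.rep)
      (fun (l : Module.Dual ℂ F) z => l z.2.rep)) P z = eval (biEval z.1.rep z.2.rep) P := by
  rw [aeval_apply_eq_eval]
  congr 2
  funext i
  rcases i with l | l <;> rfl

theorem eval_biEval_smul {m : ℕ × ℕ} {P : MvPolynomial (Module.Dual ℂ E ⊕ Module.Dual ℂ F) ℂ}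
    (hP : IsWeightedHomogeneous (Sum.elim (fun _ : Module.Dual ℂ E => ((1, 0) : ℕ × ℕ))
      (fun _ : Module.Dual ℂ F => (0, 1))) P m) (s t : ℂ) (e : E) (f : F) :
    eval (biEval (s • e) (t • f)) P = bidegreeHom s t (.ofAdd m) * eval (biEval e f) P := by
  rw [← eval_scale hP]
  congr 2
  funext i
  rcases i with l | l <;> simp [biEval, bidegreeHom]

theorem eval_biEval_mk {m : ℕ × ℕ} {P : MvPolynomial (Module.Dual ℂ E ⊕ Module.Dual ℂ F) ℂ}
    (hP : IsWeightedHomogeneous (Sum.elim (fun _ : Module.Dual ℂ E => ((1, 0) : ℕ × ℕ))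
      (fun _ : Module.Dual ℂ F => (0, 1))) P m) {e : E} (he : e ≠ 0) {f : F} (hf : f ≠ 0) :
    eval (biEval (Projectivization.mk ℂ e he).rep (Projectivization.mk ℂ f hf).rep) P ≠ 0 ↔
      eval (biEval e f) P ≠ 0 := by
  obtain ⟨s, hs⟩ := Projectivization.exists_smul_eq_mk_rep ℂ e he
  obtain ⟨t, ht⟩ := Projectivization.exists_smul_eq_mk_rep ℂ f hf
  rw [← hs, ← ht, Units.smul_def, Units.smul_def, eval_biEval_smul hP, mul_ne_zero_iff]
  exact and_iff_right (bidegreeHom_ne_zero s.ne_zero t.ne_zero _)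

theorem exists_biform_subset {O : Set (biprojSpace E F)} (hO : IsOpen O) {z : ℙ ℂ E × ℙ ℂ F}
    (hz : z ∈ O) : ∃ (m : ℕ × ℕ) (P : MvPolynomial (Module.Dual ℂ E ⊕ Module.Dual ℂ F) ℂ),
      IsWeightedHomogeneous (Sum.elim (fun _ : Module.Dual ℂ E => ((1, 0) : ℕ × ℕ))
        (fun _ : Module.Dual ℂ F => (0, 1))) P m ∧
      eval (biEval z.1.rep z.2.rep) P ≠ 0 ∧
      ∀ y : ℙ ℂ E × ℙ ℂ F, eval (biEval y.1.rep y.2.rep) P ≠ 0 → y ∈ O := by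
  obtain ⟨m, f, ⟨P, hP, hPf⟩, hz, hO⟩ := exists_form_subset (biprojForms E F) hO hz
  have h : ∀ y, f y = eval (biEval y.1.rep y.2.rep) P := fun y => by
    rw [← aeval_biproj, ← hPf]
    rfl
  rw [h] at hz
  exact ⟨m, P, hP, hz, fun y hy => hO y (by rwa [h])⟩

end ClassicalAG

/-! ### Irreducibility of ℙ_X(K). -/

namespace PfaffianCubic

open Matrix Module ClassicalAG ClassicalAG.SpaceWithFunctions
open scoped LinearAlgebra.Projectivization

universe u

variable {W : Type u} [AddCommGroup W] [Module ℂ W]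
  {V : Submodule ℂ (W [⋀^Fin 2]→ₗ[ℂ] ℂ)}

theorem linComb_gram (b : Basis (Fin 6) ℂ W) (v : Basis (Fin 6) ℂ V) (x : Fin 6 → ℂ) :
    linComb (fun k => gram b (v k)) x = gram b (v.equivFun.symm x : V) := by
  rw [v.equivFun_symm_apply, linComb]
  have h := map_sum ((gram b).comp V.subtype) (fun k => x k • v k) Finset.univ
  refine Eq.trans ?_ h.symm
  exact Finset.sum_congr rfl fun k _ => (map_smul ((gram b).comp V.subtype) _ _).symm

theorem linearIndependent_gram (b : Basis (Fin 6) ℂ W) (v : Basis (Fin 6) ℂ V) :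
    LinearIndependent ℂ fun k => gram b (v k) :=
  v.linearIndependent.map' ((gram b).comp V.subtype) (LinearMap.ker_eq_bot.2
    ((gram_injective b).comp Subtype.val_injective))

theorem finrank_ker_linComb_gram (b : Basis (Fin 6) ℂ W) (v : Basis (Fin 6) ℂ V)
    (hrank : ∀ ω ∈ V, formRank ω ≠ 2) (x : Fin 6 → ℂ)
    (hx : linComb (fun k => gram b (v k)) x ≠ 0) :
    finrank ℂ (LinearMap.ker (linComb (fun k => gram b (v k)) x).mulVecLin) ≤ 2 := by
  rw [linComb_gram] at hx ⊢
  exact finrank_ker_gram_le b (fun h => hx (by rw [h, map_zero])) (hrank _ (Subtype.mem _))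

/-- The substitution of the parametrization `(x, φ) ↦ (ω_x, Pf(ω_x) φ)` of the incidence variety
into functionals. -/
noncomputable def incidenceParam (b : Basis (Fin 6) ℂ W) (v : Basis (Fin 6) ℂ V) :
    Dual ℂ V ⊕ Dual ℂ W → MvPolynomial (Fin 6 ⊕ Fin 6) ℂ :=
  Sum.elim (fun l => ∑ k, MvPolynomial.X (Sum.inl k) * MvPolynomial.C (l (v k)))
    (fun l => ∑ i, (∑ j, pfAdj ((genericComb fun k => gram b (v k)).map
      (MvPolynomial.rename Sum.inl : MvPolynomial (Fin 6) ℂ →ₐ[ℂ] MvPolynomial (Fin 6 ⊕ Fin 6) ℂ))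
        i j * MvPolynomial.X (Sum.inr j)) * MvPolynomial.C (l (b i)))

theorem eval_aeval_incidenceParam (b : Basis (Fin 6) ℂ W) (v : Basis (Fin 6) ℂ V)
    (P : MvPolynomial (Dual ℂ V ⊕ Dual ℂ W) ℂ) (x φ : Fin 6 → ℂ) :
    MvPolynomial.eval (Sum.elim x φ) (MvPolynomial.aeval (incidenceParam b v) P) =
      MvPolynomial.eval (biEval (v.equivFun.symm x)
        (b.equivFun.symm (pfAdj (gram b (v.equivFun.symm x : V)) *ᵥ φ))) P := by
  rw [eval_aeval]
  congr 2
  funext i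
  rcases i with l | l
  · simp only [incidenceParam, biEval, Sum.elim_inl, map_sum, map_mul, MvPolynomial.eval_X,
      MvPolynomial.eval_C, v.equivFun_symm_apply, map_smul, smul_eq_mul]
  · rw [← linComb_gram]
    simp only [incidenceParam, biEval, Sum.elim_inr, map_sum, map_mul, MvPolynomial.eval_X,
      MvPolynomial.eval_C, b.equivFun_symm_apply, map_smul, smul_eq_mul, eval_rename_genericComb,
      mulVec, dotProduct]

theorem mul_pfAdj_gram_eq_zero (b : Basis (Fin 6) ℂ W) {ω : W [⋀^Fin 2]→ₗ[ℂ] ℂ}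
    (h : pf (gram b ω) = 0) : gram b ω * pfAdj (gram b ω) = 0 := by
  rw [mul_pfAdj (apply_of_transpose (gram_transpose b ω)) (diag_of_transpose (gram_transpose b ω)), h, zero_smul]

theorem pf_gram_eq_zero (b : Basis (Fin 6) ℂ W) {ω : W [⋀^Fin 2]→ₗ[ℂ] ℂ} {w : W} (hw0 : w ≠ 0)
    (hw : w ∈ formKernel ω) : pf (gram b ω) = 0 :=
  pf_eq_zero_of_mulVec_eq_zero (gram_transpose b ω) (b.equivFun.map_ne_zero_iff.2 hw0)
    ((mem_formKernel_iff b).1 hw)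

/-- For ω of rank 4 the image of the pfaffian adjoint is the whole kernel, so the parametrization
reaches every incident pair with both entries nonzero. -/
theorem exists_incidenceParam (b : Basis (Fin 6) ℂ W)
    (hrank : ∀ ω ∈ V, formRank ω ≠ 2) {ω : V} (hω : ω ≠ 0) {w : W} (hw0 : w ≠ 0)
    (hw : w ∈ formKernel (ω : W [⋀^Fin 2]→ₗ[ℂ] ℂ)) :
    ∃ φ : Fin 6 → ℂ, b.equivFun.symm (pfAdj (gram b ω) *ᵥ φ) = w := by
  have h1 := mul_pfAdj_gram_eq_zero b (pf_gram_eq_zero b hw0 hw)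
  have h2 : finrank ℂ (LinearMap.ker (gram b (ω : W [⋀^Fin 2]→ₗ[ℂ] ℂ)).mulVecLin) = 2 :=
    finrank_ker_eq_two (gram_transpose b _)
      (finrank_ker_gram_le b (fun h => hω (Subtype.ext h)) (hrank _ ω.2)) h1
  have h3 := range_pfAdj (gram_transpose b _) h1 h2
  have h4 : b.equivFun w ∈ LinearMap.range (pfAdj (gram b (ω : W [⋀^Fin 2]→ₗ[ℂ] ℂ))).mulVecLin := by
    rw [h3]
    exact (mem_formKernel_iff b).1 hw
  obtain ⟨φ, hφ⟩ := h4
  exact ⟨φ, by rw [← mulVecLin_apply, hφ, LinearEquiv.symm_apply_apply]⟩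

/-- Irreducibility of the affine incidence variety of forms and vectors in their kernels. -/
theorem exists_incidence (b : Basis (Fin 6) ℂ W) (v : Basis (Fin 6) ℂ V)
    (hrank : ∀ ω ∈ V, formRank ω ≠ 2) {P P' : MvPolynomial (Dual ℂ V ⊕ Dual ℂ W) ℂ}
    {ω ω' : V} (hω : ω ≠ 0) (hω' : ω' ≠ 0) {w w' : W} (hw0 : w ≠ 0) (hw0' : w' ≠ 0)
    (hw : w ∈ formKernel (ω : W [⋀^Fin 2]→ₗ[ℂ] ℂ)) (hw' : w' ∈ formKernel (ω' : W [⋀^Fin 2]→ₗ[ℂ] ℂ))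
    (hP : MvPolynomial.eval (biEval ω w) P ≠ 0) (hP' : MvPolynomial.eval (biEval ω' w') P' ≠ 0) :
    ∃ (ω : V) (w : W), w ∈ formKernel (ω : W [⋀^Fin 2]→ₗ[ℂ] ℂ) ∧
      MvPolynomial.eval (biEval ω w) P ≠ 0 ∧ MvPolynomial.eval (biEval ω w) P' ≠ 0 := by
  obtain ⟨φ, rfl⟩ := exists_incidenceParam b hrank hω hw0 hw
  obtain ⟨φ', rfl⟩ := exists_incidenceParam b hrank hω' hw0' hw'
  obtain ⟨x, rfl⟩ := v.equivFun.symm.surjective ω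
  obtain ⟨x', rfl⟩ := v.equivFun.symm.surjective ω'
  rw [← eval_aeval_incidenceParam] at hP hP'
  have hpf := pf_gram_eq_zero b hw0 hw
  have hpf' := pf_gram_eq_zero b hw0' hw'
  rw [← linComb_gram] at hpf hpf'
  obtain ⟨z, χ, hz, h1, h2⟩ := exists_pf_eq_zero_of_sum (linearIndependent_gram b v)
    (fun k => gram_transpose b _) (finrank_ker_linComb_gram b v hrank) hpf hP hpf' hP'
  rw [eval_aeval_incidenceParam] at h1 h2
  rw [linComb_gram] at hz
  refine ⟨_, _, (mem_formKernel_iff b).2 ?_, h1, h2⟩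
  rw [LinearEquiv.apply_symm_apply, mulVec_mulVec, mul_pfAdj_gram_eq_zero b hz, zero_mulVec]

theorem mem_PXKSet {z : ℙ ℂ V × ℙ ℂ W} :
    z ∈ PXKSet V ↔ z.2.rep ∈ formKernel (z.1.rep : W [⋀^Fin 2]→ₗ[ℂ] ℂ) := by
  have h1 : z.2.rep ∈ z.2.submodule := by
    rw [Projectivization.submodule_eq]
    exact Submodule.mem_span_singleton_self _
  refine ⟨fun h => h.2 h1, fun h => ⟨fun h0 => z.2.rep_nonzero ?_, ?_⟩⟩
  · exact (Submodule.mem_bot ℂ).1 (h0 ▸ h)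
  · rw [Projectivization.submodule_eq, Submodule.span_singleton_le_iff_mem]
    exact h

theorem mk_mem_PXKSet {ω : V} (hω : ω ≠ 0) {w : W} (hw : w ≠ 0) :
    ((Projectivization.mk ℂ ω hω, Projectivization.mk ℂ w hw) : ℙ ℂ V × ℙ ℂ W) ∈ PXKSet V ↔
      w ∈ formKernel (ω : W [⋀^Fin 2]→ₗ[ℂ] ℂ) := by
  rw [mem_PXKSet]
  change _ ∈ kernelAt V _ ↔ _
  rw [kernelAt_mk]
  obtain ⟨a, ha⟩ := Projectivization.exists_smul_eq_mk_rep ℂ w hw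
  dsimp only
  rw [← ha, Units.smul_def, Submodule.smul_mem_iff _ a.ne_zero]

theorem exists_dual_ne_zero {E : Type*} [AddCommGroup E] [Module ℂ E] {e : E} (he : e ≠ 0) :
    ∃ l : Dual ℂ E, l e ≠ 0 := by
  by_contra! h
  exact he ((Module.forall_dual_apply_eq_zero_iff ℂ e).1 h)

/-- The variety `ℙ_X(K)` is irreducible. -/
theorem PXK_inter_nonempty (b : Basis (Fin 6) ℂ W) (v : Basis (Fin 6) ℂ V)
    (hrank : ∀ ω ∈ V, formRank ω ≠ 2) {O O' : Set (PXK V)} (hO : IsOpen O) (hO' : IsOpen O')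
    (h : O.Nonempty) (h' : O'.Nonempty) : (O ∩ O').Nonempty := by
  obtain ⟨z, hz⟩ := h
  obtain ⟨z', hz'⟩ := h'
  obtain ⟨B, hB, rfl⟩ := isOpen_induced_iff.1 hO
  obtain ⟨B', hB', rfl⟩ := isOpen_induced_iff.1 hO'
  obtain ⟨m, P, hP, hPz, hPB⟩ := exists_biform_subset hB hz
  obtain ⟨m', P', hP', hPz', hPB'⟩ := exists_biform_subset hB' hz'
  obtain ⟨l, hl⟩ := exists_dual_ne_zero z.1.1.rep_nonzero
  obtain ⟨l', hl'⟩ := exists_dual_ne_zero z.1.2.rep_nonzero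
  obtain ⟨ω, w, hw, h1, h2⟩ := exists_incidence b v hrank
    -- The extra linear factors force the pair found in the affine cone to have nonzero entries, so
    -- that it defines a point.
    (P := P * (MvPolynomial.X (Sum.inl l) * MvPolynomial.X (Sum.inr l'))) (P' := P')
    z.1.1.rep_nonzero z'.1.1.rep_nonzero z.1.2.rep_nonzero z'.1.2.rep_nonzero
    (mem_PXKSet.1 z.2) (mem_PXKSet.1 z'.2)
    (by
      rw [map_mul, map_mul, MvPolynomial.eval_X, MvPolynomial.eval_X]
      exact mul_ne_zero hPz (mul_ne_zero hl hl')) hPz'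
  rw [map_mul, map_mul, MvPolynomial.eval_X, MvPolynomial.eval_X] at h1
  have hω0 : ω ≠ 0 := by
    rintro rfl
    exact h1 (by simp [biEval])
  have hw0 : w ≠ 0 := by
    rintro rfl
    exact h1 (by simp [biEval])
  refine ⟨⟨(Projectivization.mk ℂ ω hω0, Projectivization.mk ℂ w hw0),
    (mk_mem_PXKSet hω0 hw0).2 hw⟩, hPB _ ?_, hPB' _ ?_⟩
  · exact (eval_biEval_mk hP hω0 hw0).2 (left_ne_zero_of_mul h1)
  · exact (eval_biEval_mk hP' hω0 hw0).2 h2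

end PfaffianCubic

/-! ### The rational inverse of p. -/

namespace PfaffianCubic

open Matrix Module TopologicalSpace ClassicalAG ClassicalAG.SpaceWithFunctions
open scoped LinearAlgebra.Projectivization

universe u

variable {W : Type u} [AddCommGroup W] [Module ℂ W]
  {V : Submodule ℂ (W [⋀^Fin 2]→ₗ[ℂ] ℂ)}

theorem p_isMorphism : IsMorphism (p V) := by
  refine isMorphism_of_substitution (p V) fun x => ⟨⊤, trivial, AddMonoidHom.inr ℕ ℕ,
    fun l => MvPolynomial.X (Sum.inr l), fun l => MvPolynomial.isWeightedHomogeneous_X ℂ _ _,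
    fun y _ => ⟨1, fun _ => one_ne_zero, fun l => ?_⟩⟩
  rw [MvPolynomial.eval_X]
  exact (one_mul _).symm

theorem mk_mem_PXKSet_of_rep {ω : V} (hω : ω ≠ 0) {y : ℙ ℂ W}
    (h : y.rep ∈ formKernel (ω : W [⋀^Fin 2]→ₗ[ℂ] ℂ)) :
    ((Projectivization.mk ℂ ω hω, y) : ℙ ℂ V × ℙ ℂ W) ∈ PXKSet V := by
  rw [mem_PXKSet]
  change _ ∈ kernelAt V _
  rwa [kernelAt_mk]

theorem p_surjective (b : Basis (Fin 6) ℂ W) (v : Basis (Fin 6) ℂ V) :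
    Function.Surjective (p V) := fun y => by
  obtain ⟨ω, hω, h⟩ := exists_form_of_ne_zero b v (Projectivization.rep_nonzero (K := ℂ) y)
  exact ⟨⟨_, mk_mem_PXKSet_of_rep hω h⟩, rfl⟩

/-- ℙ(W) is irreducible as the image of the irreducible ℙ_X(K) under the continuous surjection p. -/
theorem projSpace_inter_nonempty (b : Basis (Fin 6) ℂ W) (v : Basis (Fin 6) ℂ V)
    (hrank : ∀ ω ∈ V, formRank ω ≠ 2) {O O' : Set (projSpace W)} (hO : IsOpen O) (hO' : IsOpen O')
    (h : O.Nonempty) (h' : O'.Nonempty) : (O ∩ O').Nonempty := by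
  obtain ⟨z, hz, hz'⟩ := PXK_inter_nonempty b v hrank (hO.preimage p_isMorphism.continuous)
    (hO'.preimage p_isMorphism.continuous) (h.preimage (p_surjective b v))
    (h'.preimage (p_surjective b v))
  exact ⟨p V z, hz, hz'⟩

/-- The points of `ℙ(W)` at which the evaluation matrix has corank one. -/
def corankOne (b : Basis (Fin 6) ℂ W) (v : Basis (Fin 6) ℂ V) : Set (projSpace W) :=
  {y : ℙ ℂ W | (evMatrix b v y.rep).adjugate ≠ 0}

theorem isOpen_adjugate_ne_zero (b : Basis (Fin 6) ℂ W) (v : Basis (Fin 6) ℂ V) (j i : Fin 6) :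
    IsOpen ({y : ℙ ℂ W | (evMatrix b v y.rep).adjugate j i ≠ 0} : Set (projSpace W)) := by
  have h := isOpen_ne_zero (projForms W) (m := 5)
    ⟨_, adjugate_evMatrixPoly_isHomogeneous b v j i, rfl⟩
  have e : {y : ℙ ℂ W | (evMatrix b v y.rep).adjugate j i ≠ 0} =
      {y : ℙ ℂ W | MvPolynomial.aeval (fun (l : Dual ℂ W) (y : ℙ ℂ W) => l y.rep)
        ((evMatrixPoly b v).adjugate j i) y ≠ 0} := by
    ext y
    rw [Set.mem_ofPred_eq, Set.mem_ofPred_eq, ← eval_adjugate_evMatrixPoly, aeval_apply_eq_eval]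
  exact (congrArg (fun s : Set (projSpace W) => IsOpen s) e).mpr h

theorem exists_adjugate_ne_zero {b : Basis (Fin 6) ℂ W} {v : Basis (Fin 6) ℂ V} {w : W}
    (h : (evMatrix b v w).adjugate ≠ 0) : ∃ j i, (evMatrix b v w).adjugate j i ≠ 0 := by
  by_contra! h0
  exact h (Matrix.ext h0)

theorem isOpen_corankOne (b : Basis (Fin 6) ℂ W) (v : Basis (Fin 6) ℂ V) :
    IsOpen (corankOne b v) := by
  refine isOpen_iff_mem_nhds.2 fun y hy => ?_
  obtain ⟨j, i, hij⟩ := exists_adjugate_ne_zero hy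
  exact Filter.mem_of_superset ((isOpen_adjugate_ne_zero b v j i).mem_nhds hij)
    fun z hz h0 => hz (congrFun (congrFun h0 j) i)

theorem exists_smul_eq_of_finrank_ker_le_one {E F : Type*} [AddCommGroup E] [Module ℂ E]
    [AddCommGroup F] [Module ℂ F] [Module.Finite ℂ E] (f : E →ₗ[ℂ] F)
    (h : finrank ℂ (LinearMap.ker f) ≤ 1) :
    ∃ x : E, ∀ y ∈ LinearMap.ker f, ∃ c : ℂ, y = c • x := by
  obtain ⟨x, h⟩ := finrank_le_one_iff.1 h
  refine ⟨x, fun y hy => ?_⟩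
  obtain ⟨c, hc⟩ := h ⟨y, hy⟩
  exact ⟨c, congrArg Subtype.val hc.symm⟩

/-- A vector killed by at most one form of V up to scalars exists by
`exists_finrank_ker_evalAt_le_one`, and the adjugate does not vanish there. -/
theorem corankOne_nonempty (b : Basis (Fin 6) ℂ W) (v : Basis (Fin 6) ℂ V)
    (hrank : ∀ ω ∈ V, formRank ω ≠ 2) : (corankOne b v).Nonempty := by
  have h6 : finrank ℂ (V.map (gram b)) = 6 := by
    rw [← (Submodule.equivMapOfInjective _ (gram_injective b) V).finrank_eq,
      finrank_eq_card_basis v, Fintype.card_fin]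
  obtain ⟨e, he⟩ := exists_finrank_ker_evalAt_le_one (V := V.map (gram b))
    (by rintro _ ⟨ω, _, rfl⟩; exact gram_transpose b ω)
    (by
      rintro _ ⟨ω, hω, rfl⟩ h0
      exact finrank_ker_gram_le b (fun h => h0 (by rw [h, map_zero])) (hrank ω hω)) h6
  have he0 : e ≠ 0 := by
    rintro rfl
    have : evalAt (V.map (gram b)) 0 = 0 := by
      ext1 A
      rw [evalAt_apply, mulVec_zero]
      rfl
    rw [this, LinearMap.ker_zero, finrank_top, h6] at he
    omega
  have hw : b.equivFun.symm e ≠ 0 := b.equivFun.symm.map_ne_zero_iff.2 he0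
  obtain ⟨A, hA⟩ := exists_smul_eq_of_finrank_ker_le_one _ he
  obtain ⟨a, ha⟩ := Projectivization.exists_smul_eq_mk_rep ℂ _ hw
  have key : ∀ ω : V, (Projectivization.mk ℂ _ hw).rep ∈ formKernel (ω : W [⋀^Fin 2]→ₗ[ℂ] ℂ) →
      ∃ c : ℂ, gram b ω = c • (A : V.map (gram b)) := fun ω h => by
    rw [← ha, Units.smul_def, Submodule.smul_mem_iff _ a.ne_zero, mem_formKernel_iff b,
      LinearEquiv.apply_symm_apply] at h
    obtain ⟨c, hc⟩ := hA ⟨gram b ω, Submodule.mem_map_of_mem ω.2⟩ h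
    exact ⟨c, congrArg Subtype.val hc⟩
  obtain ⟨i, j, hij⟩ := adjugate_ne_zero_of_unique b v (Projectivization.mk ℂ _ hw).rep_nonzero
    fun ω ω' h h' h0 => by
      obtain ⟨c, hc⟩ := key ω h
      obtain ⟨c', hc'⟩ := key ω' h'
      have hc0 : c ≠ 0 := by
        rintro rfl
        rw [zero_smul, ← map_zero (gram b)] at hc
        exact h0 (Subtype.ext (gram_injective b hc))
      refine ⟨c' / c, Subtype.ext (gram_injective b ?_)⟩
      rw [hc', Submodule.coe_smul, map_smul, hc, smul_smul, div_mul_cancel₀ _ hc0]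
  exact ⟨Projectivization.mk ℂ _ hw, fun h0 => hij (congrFun (congrFun h0 j) i)⟩

theorem eq_of_mem_corankOne {b : Basis (Fin 6) ℂ W} {v : Basis (Fin 6) ℂ V} {z z' : PXK V}
    (hz : p V z ∈ corankOne b v) (h : p V z = p V z') : z = z' := by
  obtain ⟨j, i, hij⟩ := exists_adjugate_ne_zero hz
  have h2 : z.1.2 = z'.1.2 := h
  have h3 := mem_PXKSet.1 z'.2
  rw [← h2] at h3
  obtain ⟨c, hc⟩ := eq_smul_of_adjugate_ne_zero b v hij z'.1.1.rep_nonzero h3 (mem_PXKSet.1 z.2)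
  refine Subtype.ext (Prod.ext ?_ h2)
  rw [← z.1.1.mk_rep, ← z'.1.1.mk_rep, Projectivization.mk_eq_mk_iff']
  exact ⟨c, hc.symm⟩

theorem dense_of_inter_nonempty {X : Type*} [TopologicalSpace X]
    (hX : ∀ O O' : Set X, IsOpen O → IsOpen O' → O.Nonempty → O'.Nonempty → (O ∩ O').Nonempty)
    {O : Set X} (hO : IsOpen O) (h : O.Nonempty) : Dense O :=
  dense_iff_inter_open.2 fun _ hO' h' => hX _ _ hO' hO h' h

/-- The rational inverse of `p`, defined where the evaluation matrix has corank one. -/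
noncomputable def inverseMap (b : Basis (Fin 6) ℂ W) (v : Basis (Fin 6) ℂ V)
    (hrank : ∀ ω ∈ V, formRank ω ≠ 2) : PartialMap (projSpace W) (PXK V) where
  domain := ⟨corankOne b v, isOpen_corankOne b v⟩
  dense_domain := dense_of_inter_nonempty (fun _ _ => projSpace_inter_nonempty b v hrank)
    (isOpen_corankOne b v) (corankOne_nonempty b v hrank)
  toFun y := Function.surjInv (p_surjective b v) y.1
  isMorphism := by
    refine isMorphism_restrict _ (isMorphism_of_substitution _ fun x => ?_)
    obtain ⟨j, i, hij⟩ := exists_adjugate_ne_zero x.2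
    -- The V-coordinates of the inverse are row j of the adjugate, of degree 5, and the
    -- W-coordinates are those of the point, of degree 1; hence the degree map (a, b) ↦ 5a + b.
    refine ⟨⟨_, isOpen_adjugate_ne_zero b v j i⟩, hij,
      AddMonoidHom.coprod (5 • AddMonoidHom.id ℕ) (AddMonoidHom.id ℕ),
      Sum.elim (fun l => ∑ k, (evMatrixPoly b v).adjugate j k * MvPolynomial.C (l (v k)))
        (fun l => MvPolynomial.X l), ?_, fun y hy => ?_⟩
    · rintro (l | l)
      · refine MvPolynomial.IsWeightedHomogeneous.sum _ _ _ fun k _ => ?_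
        exact MvPolynomial.IsWeightedHomogeneous.mul (adjugate_evMatrixPoly_isHomogeneous b v j k)
          (MvPolynomial.isWeightedHomogeneous_C _ _)
      · exact MvPolynomial.isWeightedHomogeneous_X ℂ _ _
    · have hp : (Function.surjInv (p_surjective b v) y.1).1.2 = y.1 :=
        Function.surjInv_eq (p_surjective b v) y.1
      have hmem := mem_PXKSet.1 (Function.surjInv (p_surjective b v) y.1).2
      rw [hp] at hmem
      obtain ⟨c, hc⟩ := eq_smul_of_adjugate_ne_zero b v hy (adjForm_ne_zero b v hy)
        (mem_formKernel_adjForm b v j (Projectivization.rep_nonzero (K := ℂ) y.1)) hmem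
      have hc0 : c ≠ 0 := by
        rintro rfl
        rw [zero_smul] at hc
        exact Projectivization.rep_nonzero _ hc
      -- The scalar c compares the chosen representative of the form with the adjugate row.
      refine ⟨bidegreeHom c 1, bidegreeHom_ne_zero hc0 one_ne_zero, ?_⟩
      rintro (l | l)
      · simp only [Sum.elim_inl, hc, map_smul, adjForm, map_sum, map_mul, MvPolynomial.eval_C,
          eval_adjugate_evMatrixPoly, smul_eq_mul]
        simp [bidegreeHom]
      · simp only [Sum.elim_inr, hp, MvPolynomial.eval_X]
        simp [bidegreeHom]

theorem inverseMap_isRationalInverse (b : Basis (Fin 6) ℂ W) (v : Basis (Fin 6) ℂ V)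
    (hrank : ∀ ω ∈ V, formRank ω ≠ 2) : IsRationalInverse (p V) (inverseMap b v hrank) := by
  have hopen : IsOpen (p V ⁻¹' corankOne b v) :=
    (isOpen_corankOne b v).preimage p_isMorphism.continuous
  refine ⟨⟨_, hopen⟩, (inverseMap b v hrank).domain, le_rfl,
    dense_of_inter_nonempty (fun _ _ => PXK_inter_nonempty b v hrank) hopen
      ((corankOne_nonempty b v hrank).preimage (p_surjective b v)),
    (inverseMap b v hrank).dense_domain, fun x hx => ⟨hx, ?_⟩, fun y hy => ?_⟩
  · exact (eq_of_mem_corankOne hx (Function.surjInv_eq (p_surjective b v) _).symm).symm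
  · have h := Function.surjInv_eq (p_surjective b v) y
    refine ⟨?_, h⟩
    change p V _ ∈ corankOne b v
    exact h.symm ▸ hy

end PfaffianCubic

/-! ### Open conditions and regular functions on a product of projective spaces. -/

namespace ClassicalAG

open MvPolynomial SpaceWithFunctions TopologicalSpace
open scoped LinearAlgebra.Projectivization

universe u

variable {E F : Type u} [AddCommGroup E] [Module ℂ E] [AddCommGroup F] [Module ℂ F]

theorem isOpen_biform_ne_zero {m : ℕ × ℕ} {P : MvPolynomial (Module.Dual ℂ E ⊕ Module.Dual ℂ F) ℂ}
    (hP : IsWeightedHomogeneous (Sum.elim (fun _ : Module.Dual ℂ E => ((1, 0) : ℕ × ℕ))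
      (fun _ : Module.Dual ℂ F => (0, 1))) P m) :
    IsOpen ({z : ℙ ℂ E × ℙ ℂ F | eval (biEval z.1.rep z.2.rep) P ≠ 0} : Set (biprojSpace E F)) := by
  have h := isOpen_ne_zero (biprojForms E F) ⟨P, hP, rfl⟩
  have e : {z : ℙ ℂ E × ℙ ℂ F | eval (biEval z.1.rep z.2.rep) P ≠ 0} =
      {z : ℙ ℂ E × ℙ ℂ F | aeval (Sum.elim (fun (l : Module.Dual ℂ E) (z : ℙ ℂ E × ℙ ℂ F) => l z.1.rep)
      (fun (l : Module.Dual ℂ F) z => l z.2.rep)) P z ≠ 0} := by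
    ext z
    rw [Set.mem_ofPred_eq, Set.mem_ofPred_eq, aeval_biproj]
  exact (congrArg (fun s : Set (biprojSpace E F) => IsOpen s) e).mpr h

/-- The quotient of two linear functionals in the first factor is a regular function. -/
theorem div_dual_mem_reg (l m : Module.Dual ℂ E) {U : Opens (biprojSpace E F)}
    (h : ∀ z : ℙ ℂ E × ℙ ℂ F, z ∈ (U : Set (biprojSpace E F)) → m z.1.rep ≠ 0) :
    (fun z : U => l (Prod.fst (α := ℙ ℂ E) (β := ℙ ℂ F) z.1).rep /
      m (Prod.fst (α := ℙ ℂ E) (β := ℙ ℂ F) z.1).rep) ∈ (biprojSpace E F).reg U := by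
  have hX : ∀ l : Module.Dual ℂ E, (fun z : ℙ ℂ E × ℙ ℂ F => l z.1.rep) ∈ biprojForms E F (1, 0) :=
    fun l => ⟨X (Sum.inl l), isWeightedHomogeneous_X ℂ _ _, aeval_X _ _⟩
  exact div_mem_reg (biprojForms E F) (hX l) (hX m) h

/-- The vanishing of the difference of cross products of forms and functionals is closed. -/
theorem isOpen_cross_ne_zero (l m : Module.Dual ℂ E) {d : ℕ}
    {A B : MvPolynomial (Module.Dual ℂ F) ℂ} (hA : A.IsHomogeneous d) (hB : B.IsHomogeneous d) :
    IsOpen ({z : ℙ ℂ E × ℙ ℂ F | l z.1.rep * eval (fun l => l z.2.rep) B -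
      m z.1.rep * eval (fun l => l z.2.rep) A ≠ 0} : Set (biprojSpace E F)) := by
  have hr : ∀ A : MvPolynomial (Module.Dual ℂ F) ℂ, A.IsHomogeneous d →
      IsWeightedHomogeneous (Sum.elim (fun _ : Module.Dual ℂ E => ((1, 0) : ℕ × ℕ))
        (fun _ : Module.Dual ℂ F => (0, 1))) (aeval (fun l => X (R := ℂ) (Sum.inr l)) A) (0, d) :=
    fun A hA => isWeightedHomogeneous_aeval (w' := fun _ : Module.Dual ℂ F => 1)
      (θ := AddMonoidHom.inr ℕ ℕ) (fun l => isWeightedHomogeneous_X ℂ _ (Sum.inr l)) hA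
  have hP := ((isWeightedHomogeneous_X ℂ (Sum.elim (fun _ : Module.Dual ℂ E => ((1, 0) : ℕ × ℕ))
      (fun _ : Module.Dual ℂ F => (0, 1))) (Sum.inl l)).mul (hr B hB)).sub
    ((isWeightedHomogeneous_X ℂ _ (Sum.inl m)).mul (hr A hA))
  have h := isOpen_biform_ne_zero hP
  have e : ∀ (z : ℙ ℂ E × ℙ ℂ F) (l : Module.Dual ℂ E) (B : MvPolynomial (Module.Dual ℂ F) ℂ),
      eval (biEval z.1.rep z.2.rep) (X (Sum.inl l) * aeval (fun l => X (R := ℂ) (Sum.inr l)) B) =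
        l z.1.rep * eval (fun l => l z.2.rep) B := fun z l B => by
    rw [map_mul, eval_X, eval_aeval]
    simp only [eval_X]
    rfl
  simpa only [map_sub, e] using h

end ClassicalAG

/-! ### The indeterminacy locus is the locus of corank at least two. -/

namespace PfaffianCubic

open Matrix Module TopologicalSpace ClassicalAG ClassicalAG.SpaceWithFunctions
open scoped LinearAlgebra.Projectivization

universe u

variable {W : Type u} [AddCommGroup W] [Module ℂ W]
  {V : Submodule ℂ (W [⋀^Fin 2]→ₗ[ℂ] ℂ)}

/-- Wherever both are sections of p over `corankOne`, g and `inverseMap` agree, as the fibres there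
are single points. So `inverseMap` represents the same rational map. -/
theorem corankOne_subset_domainOfDefinition (b : Basis (Fin 6) ℂ W) (v : Basis (Fin 6) ℂ V)
    (hrank : ∀ ω ∈ V, formRank ω ≠ 2) {g : PartialMap (projSpace W) (PXK V)}
    (hg : IsRationalInverse (p V) g) : corankOne b v ⊆ g.domainOfDefinition := by
  obtain ⟨U, U', hU', -, hd', -, h2⟩ := hg
  intro y hy
  refine ⟨inverseMap b v hrank, ⟨U' ⊓ (inverseMap b v hrank).domain,
    hd'.inter_of_isOpen_left (inverseMap b v hrank).dense_domain U'.isOpen,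
    inf_le_right, inf_le_left.trans hU', fun x hx => ?_⟩, hy⟩
  have h := Function.surjInv_eq (p_surjective b v) x
  refine eq_of_mem_corankOne (b := b) (v := v) ?_ (h.trans (h2 x hx.1).2.symm)
  change p V (Function.surjInv (p_surjective b v) x) ∈ _
  rw [h]
  exact hx.2

/-- Over a point at which the evaluation matrix has corank greater than one, the fibre of `p`
contains a point different from a given one. -/
theorem exists_ne_of_notMem_corankOne {b : Basis (Fin 6) ℂ W} {v : Basis (Fin 6) ℂ V}
    {y : ℙ ℂ W} (hy : y ∉ (corankOne b v : Set (projSpace W))) (x : ℙ ℂ V) :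
    ∃ x' : ℙ ℂ V, x' ≠ x ∧ ((x', y) : ℙ ℂ V × ℙ ℂ W) ∈ PXKSet V := by
  by_contra! hcon
  refine hy fun h0 => ?_
  obtain ⟨i, j, hij⟩ := adjugate_ne_zero_of_unique b v y.rep_nonzero fun ω ω' h h' hω => by
    by_cases hω' : ω' = 0
    · exact ⟨0, by rw [hω', zero_smul]⟩
    have h1 : ∀ (ω : V) (hω : ω ≠ 0), y.rep ∈ formKernel (ω : W [⋀^Fin 2]→ₗ[ℂ] ℂ) →
        Projectivization.mk ℂ ω hω = x := fun ω hω h => by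
      by_contra hne
      exact hcon _ hne (mk_mem_PXKSet_of_rep hω h)
    obtain ⟨c, hc⟩ := (Projectivization.mk_eq_mk_iff' ℂ _ _ hω' hω).1
      ((h1 ω' hω' h').trans (h1 ω hω h).symm)
    exact ⟨c, hc.symm⟩
  exact hij (congrFun (congrFun h0 j) i)

theorem exists_dual_separating {E : Type*} [AddCommGroup E] [Module ℂ E] {x x' : ℙ ℂ E}
    (h : x' ≠ x) : ∃ l : Dual ℂ E, l x.rep = 0 ∧ l x'.rep ≠ 0 := by
  have h1 : x'.rep ∉ ℂ ∙ x.rep := fun hmem => by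
    obtain ⟨c, hc⟩ := Submodule.mem_span_singleton.1 hmem
    refine h ?_
    rw [← x.mk_rep, ← x'.mk_rep, Projectivization.mk_eq_mk_iff']
    exact ⟨c, hc⟩
  obtain ⟨l, hl, hle⟩ := Submodule.exists_le_ker_of_notMem h1
  exact ⟨l, hle (Submodule.mem_span_singleton_self _), hl⟩

/-- Suppose a representative h is defined at y and (x, y) is a second point of the fibre. Take l
vanishing at the first coordinate of h(y) but not at x, and m nonvanishing at that coordinate. Near
y the pullback of l/m is A/B with A(y) = 0. The form lB - mA is nonzero at (x, y), yet it vanishes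
at points z over a neighbourhood of y with h(p(z)) = z and m nonzero there. By irreducibility these
meet its nonvanishing locus, a contradiction. -/
theorem domainOfDefinition_subset_corankOne (b : Basis (Fin 6) ℂ W) (v : Basis (Fin 6) ℂ V)
    (hrank : ∀ ω ∈ V, formRank ω ≠ 2) {g : PartialMap (projSpace W) (PXK V)}
    (hg : IsRationalInverse (p V) g) : g.domainOfDefinition ⊆ corankOne b v := by
  obtain ⟨U, U', hU', hd, hd', h1, h2⟩ := hg
  rintro y ⟨h, ⟨D, hD, hDh, hDg, hD'⟩, hy⟩
  by_contra hny
  obtain ⟨x, hx, hmem⟩ := exists_ne_of_notMem_corankOne hny (h.toFun ⟨y, hy⟩).1.1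
  obtain ⟨l, hl0, hl⟩ := exists_dual_separating hx
  obtain ⟨m, hm⟩ := exists_dual_ne_zero (h.toFun ⟨y, hy⟩).1.1.rep_nonzero
  let N₀ : Opens (biprojSpace V W) := ⟨_, isOpen_biform_ne_zero (E := V) (F := W)
    (MvPolynomial.isWeightedHomogeneous_X ℂ _ (Sum.inl m))⟩
  have hN₀ : ∀ z : ℙ ℂ V × ℙ ℂ W, z ∈ (N₀ : Set (biprojSpace V W)) ↔ m z.1.rep ≠ 0 := fun z => by
    change MvPolynomial.eval _ (MvPolynomial.X _) ≠ 0 ↔ _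
    rw [MvPolynomial.eval_X]
    rfl
  let N₁ : Opens (PXK V) := ⟨Subtype.val ⁻¹' N₀, N₀.isOpen.preimage continuous_subtype_val⟩
  have hreg : (fun z : N₁ => l z.1.1.1.rep / m z.1.1.1.rep) ∈ (PXK V).reg N₁ := fun z =>
    ⟨N₀, _, div_dual_mem_reg l m fun z hz => (hN₀ z).1 hz, z.2, fun _ _ => rfl⟩
  obtain ⟨N₂, f, hf, hyN₂, hfe⟩ := h.isMorphism.pullback N₁ _ hreg ⟨⟨y, hy⟩, (hN₀ _).2 hm⟩
  obtain ⟨(N₃ : Opens (projSpace W)), d, _, _, ⟨A, hA, rfl⟩, ⟨B, hB, rfl⟩, hyN₃, hfe'⟩ := hf ⟨y, hyN₂⟩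
  have hq : ∀ (y' : ℙ ℂ W) (hy' : y' ∈ (h.domain : Set (projSpace W))),
      y' ∈ (N₂ : Set (projSpace W)) → y' ∈ (N₃ : Set (projSpace W)) →
      m (h.toFun ⟨y', hy'⟩).1.1.rep ≠ 0 → MvPolynomial.eval (fun l => l y'.rep) B ≠ 0 ∧
        l (h.toFun ⟨y', hy'⟩).1.1.rep / m (h.toFun ⟨y', hy'⟩).1.1.rep =
          MvPolynomial.eval (fun l => l y'.rep) A / MvPolynomial.eval (fun l => l y'.rep) B :=
    fun y' hy' hy₂ hy₃ hm' => by
      have e := fun P => aeval_apply_eq_eval (fun (l : Dual ℂ W) (x : ℙ ℂ W) => l x.rep) P y'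
      obtain ⟨hB0, hAB⟩ := hfe' ⟨y', hy₂⟩ hy₃
      refine ⟨fun h0 => hB0 ((e B).trans h0), ?_⟩
      rw [← e, ← e]
      exact (hfe ⟨⟨y', hy'⟩, (hN₀ _).2 hm'⟩ hy₂).trans hAB
  obtain ⟨hB0, hAB⟩ := hq y hy hyN₂ hyN₃ hm
  rw [hl0, zero_div, eq_comm, div_eq_zero_iff, or_iff_left hB0] at hAB
  obtain ⟨O, hO, hOe⟩ := isOpen_induced_iff.1 (N₁.isOpen.preimage h.isMorphism.continuous)
  have hmemO : ∀ (y' : ℙ ℂ W) (hy' : y' ∈ (h.domain : Set (projSpace W))),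
      y' ∈ O ↔ m (h.toFun ⟨y', hy'⟩).1.1.rep ≠ 0 := fun y' hy' =>
    (Set.ext_iff.1 hOe ⟨y', hy'⟩).trans (hN₀ _)
  have hpc := (p_isMorphism (V := V)).continuous
  have hcross := (isOpen_cross_ne_zero l m hA hB).preimage
    (continuous_subtype_val : Continuous (Subtype.val : PXKSet V → _))
  have hQ : IsOpen (p V ⁻¹' (((N₂ : Set (projSpace W)) ∩ N₃) ∩ (O ∩ h.domain)) ∩
      Subtype.val ⁻¹' {z : ℙ ℂ V × ℙ ℂ W | l z.1.rep * MvPolynomial.eval (fun l => l z.2.rep) B -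
        m z.1.rep * MvPolynomial.eval (fun l => l z.2.rep) A ≠ 0} : Set (PXK V)) :=
    (((N₂.isOpen.inter N₃.isOpen).inter (hO.inter h.domain.isOpen)).preimage hpc).inter hcross
  -- The point z lies over D, where h agrees with g, and in U, where g inverts p. Hence h(p(z)) = z.
  obtain ⟨z, ⟨⟨⟨⟨hz₂, hz₃⟩, hzO, hzh⟩, hz⟩, hzD⟩, hzU⟩ := hd.inter_open_nonempty _
    (hQ.inter (D.isOpen.preimage hpc))
    (PXK_inter_nonempty b v hrank hQ (D.isOpen.preimage hpc)
      ⟨⟨(x, y), hmem⟩, ⟨⟨⟨hyN₂, hyN₃⟩, (hmemO y hy).2 hm, hy⟩, by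
        change _ - _ ≠ (0 : ℂ)
        rw [hAB, mul_zero, sub_zero]
        exact mul_ne_zero hl hB0⟩⟩
      (Set.Nonempty.preimage (hD.nonempty_iff.2 ⟨y⟩) (p_surjective b v)))
  obtain ⟨hzU', hgz⟩ := h1 z hzU
  have hhz : h.toFun ⟨p V z, hzh⟩ = z := (hD' _ hzD).trans hgz
  have hmz := (hmemO _ hzh).1 hzO
  obtain ⟨hBz, hABz⟩ := hq _ hzh hz₂ hz₃ hmz
  rw [hhz] at hmz hABz
  rw [div_eq_div_iff hmz hBz] at hABz
  refine hz ?_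
  change l z.1.1.rep * MvPolynomial.eval (fun l => l (p V z : ℙ ℂ W).rep) B -
    m z.1.1.rep * MvPolynomial.eval (fun l => l (p V z : ℙ ℂ W).rep) A = 0
  rw [hABz]
  ring

theorem indeterminacyLocus_eq (b : Basis (Fin 6) ℂ W) (v : Basis (Fin 6) ℂ V)
    (hrank : ∀ ω ∈ V, formRank ω ≠ 2) {g : PartialMap (projSpace W) (PXK V)}
    (hg : IsRationalInverse (p V) g) : g.indeterminacyLocus = (corankOne b v)ᶜ := by
  rw [PartialMap.indeterminacyLocus, compl_inj_iff]
  exact (domainOfDefinition_subset_corankOne b v hrank hg).antisymm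
    (corankOne_subset_domainOfDefinition b v hrank hg)

end PfaffianCubic

/-! ### The image of q. -/

namespace PfaffianCubic

open Matrix Module ClassicalAG ClassicalAG.SpaceWithFunctions
open scoped LinearAlgebra.Projectivization

universe u

variable {W : Type u} [AddCommGroup W] [Module ℂ W]
  {V : Submodule ℂ (W [⋀^Fin 2]→ₗ[ℂ] ℂ)}

theorem ιMulti_mem_annihilator {w u : W} :
    exteriorPower.ιMulti ℂ 2 ![w, u] ∈ annihilator V ↔ ∀ ω ∈ V, ω ![w, u] = 0 := by
  simp only [annihilator, Submodule.mem_iInf, LinearMap.mem_ker,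
    exteriorPower.alternatingMapLinearEquiv_apply_ιMulti]

theorem ιMulti_mem_range_map {U : Submodule ℂ W} {w u : W} (hw : w ∈ U) (hu : u ∈ U) :
    exteriorPower.ιMulti ℂ 2 ![w, u] ∈ LinearMap.range (exteriorPower.map 2 U.subtype) := by
  refine ⟨exteriorPower.ιMulti ℂ 2 ![⟨w, hw⟩, ⟨u, hu⟩], ?_⟩
  rw [exteriorPower.map_apply_ιMulti]
  congr 1
  ext i
  fin_cases i <;> rfl

theorem linearIndependent_of_notMem_span {w u : W} (hw : w ≠ 0) (hu : u ∉ ℂ ∙ w) :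
    LinearIndependent ℂ ![w, u] := by
  refine (LinearIndependent.pair_iff' hw).2 fun a h => hu ?_
  rw [← h]
  exact Submodule.smul_mem _ _ (Submodule.mem_span_singleton_self _)

theorem finrank_range_map_subtype {U : Submodule ℂ W} (hU : finrank ℂ U = 2) :
    finrank ℂ (LinearMap.range (exteriorPower.map 2 U.subtype)) = 1 := by
  have : Module.Finite ℂ U := Module.finite_of_finrank_eq_succ hU
  rw [LinearMap.finrank_range_of_inj (exteriorPower.map_injective_field U.injective_subtype),
    exteriorPower.finrank_eq, hU, Nat.choose_self]

theorem range_map_subtype_le_annihilator {w u : W} (h : ∀ ω ∈ V, ω ![w, u] = 0) :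
    LinearMap.range (exteriorPower.map 2 (Submodule.span ℂ (Set.range ![w, u])).subtype) ≤
      annihilator V := by
  rw [← Submodule.map_top, ← exteriorPower.ιMulti_span, Submodule.map_span, Submodule.span_le]
  rintro _ ⟨_, ⟨a, rfl⟩, rfl⟩
  rw [exteriorPower.map_apply_ιMulti]
  have ha : (Submodule.span ℂ (Set.range ![w, u])).subtype ∘ a = ![(a 0 : W), (a 1 : W)] := by
    ext i
    fin_cases i <;> rfl
  rw [ha]
  refine ιMulti_mem_annihilator.2 fun ω hω => ?_
  have hmem : ∀ x ∈ Submodule.span ℂ (Set.range ![w, u]), ∃ c d : ℂ, c • w + d • u = x :=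
    fun x hx => by rwa [range_cons_cons_empty, Submodule.mem_span_pair] at hx
  obtain ⟨c, d, h0⟩ := hmem _ (a 0).2
  obtain ⟨c', d', h1⟩ := hmem _ (a 1).2
  rw [← pairing_apply, ← h0, ← h1]
  simp only [map_add, map_smul, LinearMap.add_apply, LinearMap.smul_apply, pairing_apply,
    alternating_self, alternating_swap ω u w, h ω hω, neg_zero, smul_zero, add_zero]

/-- A plane U spanned by w and u has Λ²U ⊂ V^⊥ exactly when every form of V vanishes on (w, u). So
points of S whose plane contains w correspond to right kernel vectors of the evaluation matrix
outside ℂw. -/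
theorem range_q (b : Basis (Fin 6) ℂ W) (v : Basis (Fin 6) ℂ V) :
    Set.range (q V) = (corankOne b v)ᶜ := by
  ext (y : ℙ ℂ W)
  have hy : y ∈ (corankOne b v : Set (projSpace W))ᶜ ↔
      ∃ u, u ∉ ℂ ∙ y.rep ∧ ∀ ω ∈ V, ω ![y.rep, u] = 0 := by
    rw [← adjugate_eq_zero_iff b v y.rep_nonzero]
    exact not_not
  refine Iff.trans ?_ hy.symm
  constructor
  · rintro ⟨⟨z, ⟨-, hz⟩, U, ⟨hU, hzU⟩, hle⟩, rfl⟩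
    change ∃ u, u ∉ ℂ ∙ z.2.rep ∧ ∀ ω ∈ V, ω ![z.2.rep, u] = 0
    have hw : z.2.rep ∈ U := hle (by
      rw [Projectivization.submodule_eq]
      exact Submodule.mem_span_singleton_self _)
    have hnle : ¬ U ≤ ℂ ∙ z.2.rep := fun h => by
      have := Submodule.finrank_mono h
      have := finrank_span_singleton (K := ℂ) z.2.rep_nonzero
      omega
    obtain ⟨u, huU, hu⟩ := SetLike.not_le_iff_exists.1 hnle
    refine ⟨u, hu, ιMulti_mem_annihilator.1 (hz ?_)⟩
    rw [hzU]
    exact ιMulti_mem_range_map hw huU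
  · rintro ⟨u, hu, h⟩
    have hU : finrank ℂ (Submodule.span ℂ (Set.range ![y.rep, u])) = 2 := by
      rw [finrank_span_eq_card (linearIndependent_of_notMem_span y.rep_nonzero hu), Fintype.card_fin]
    let s : ℙ ℂ (⋀[ℂ]^2 W) := Projectivization.mk'' _ (finrank_range_map_subtype hU)
    have hs : IsPluckerPoint (Submodule.span ℂ (Set.range ![y.rep, u])) s :=
      ⟨hU, Projectivization.submodule_mk'' _ _⟩
    refine ⟨⟨(s, y), ⟨⟨_, hs⟩, ?_⟩, _, hs, ?_⟩, rfl⟩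
    · change Projectivization.submodule s ≤ _
      rw [hs.2]
      exact range_map_subtype_le_annihilator h
    · rw [Projectivization.submodule_eq, Submodule.span_singleton_le_iff_mem]
      exact Submodule.subset_span ⟨0, rfl⟩

end PfaffianCubic

theorem mainTheorem6 {W : Type*} [AddCommGroup W] [Module ℂ W] (hW : Module.finrank ℂ W = 6)
    (V : Submodule ℂ (W [⋀^Fin 2]→ₗ[ℂ] ℂ)) (hV : Module.finrank ℂ V = 6)
    (hrank : ∀ ω ∈ V, PfaffianCubic.formRank ω ≠ 2) :
    ClassicalAG.SpaceWithFunctions.IsBirational (PfaffianCubic.p V) ∧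
    ∀ g : ClassicalAG.SpaceWithFunctions.PartialMap
        (ClassicalAG.projSpace W) (PfaffianCubic.PXK V),
      ClassicalAG.SpaceWithFunctions.IsRationalInverse (PfaffianCubic.p V) g →
        g.indeterminacyLocus = Set.range (PfaffianCubic.q V) := by
  have : Module.Finite ℂ W := Module.finite_of_finrank_eq_succ hW
  have : Module.Finite ℂ V := Module.finite_of_finrank_eq_succ hV
  let b := Module.finBasisOfFinrankEq ℂ W hW
  let v := Module.finBasisOfFinrankEq ℂ V hV
  refine ⟨⟨PfaffianCubic.p_isMorphism, _,
    PfaffianCubic.inverseMap_isRationalInverse b v hrank⟩, fun g hg => ?_⟩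
  rw [PfaffianCubic.indeterminacyLocus_eq b v hrank hg, PfaffianCubic.range_q b v]
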